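/- Consider $3\times3\times3$ tensors $X=[x_{ijk}]$ ($1\le i,j,k\le 3$) over the field $\mathbb{F}_2$ with two elements. A simple tensor is an outer product $a\otimes b\otimes c$, with entries $a_ib_jc_k$, of nonzero vectors $a,b,c\in\mathbb{F}_2^3$; the rank of $X$ is the least $n\ge 0$ such that $X$ is a sum of $n$ simple tensors. The group $GL_3(\mathbb{F}_2)^3=GL_3(\mathbb{F}_2)\times GL_3(\mathbb{F}_2)\times GL_3(\mathbb{F}_2)$ acts by $$((A,B,C)\cdot X)_{i_1j_1k_1}=\sum_{i_2,j_2,k_2} A_{i_1i_2}B_{j_1j_2}C_{k_1k_2}\,x_{i_2j_2k_2},$$ and $GL_3(\mathbb{F}_2)^3\rtimes S_3$ acts in addition by permuting the three directions. The orbits of the former group are called small, those of the latter large. The flattening of $X$ is the sequence $x_{111},x_{112},\dots,x_{333}$ of its 27 entries in lexicographic order of subscripts; it is the binary representation of an integer, the encoding of $X$, and tensors are ordered by their encodings. The canonical form of an orbit is its minimal element. There are exactly 115 small orbits and exactly 55 large orbits of nonzero tensors. The large orbits of nonzero tensors are, each exactly once, those in the following table, which gives for each orbit the common rank of its elements, its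 number of elements, and the flattening of its canonical form. $$\begin{array}{rrrl} \# & \text{rank} & \text{size} & \text{canonical form}\\ \hline 1 & 1 & 343 & \texttt{000000000 000000000 000000001}\\ 2 & 2 & 6174 & \texttt{000000000 000000000 000001010}\\ 3 & 2 & 37044 & \texttt{000000000 000000001 000010000}\\ 4 & 3 & 3528 & \texttt{000000000 000000000 001010100}\\ 5 & 3 & 4116 & \texttt{000000000 000001010 000010011}\\ 6 & 3 & 18522 & \texttt{000000000 000000001 000001010}\\ 7 & 3 & 148176 & \texttt{000000000 000001010 000010100}\\ 8 & 3 & 222264 & \texttt{000000000 000000001 000010100}\\ 9 & 3 & 592704 & \texttt{000000000 000000001 010100000}\\ 10 & 3 & 592704 & \texttt{000000000 000001010 100000010}\\ 11 & 3 & 790272 & \texttt{000000001 000010000 100000000}\\ 12 & 4 & 148176 & \texttt{000000000 000001010 001000100}\\ 13 & 4 & 197568 & \texttt{000001010 001000100 010110010}\\ 14 & 4 & 222264 & \texttt{000000000 000000001 001010100}\\ 15 & 4 & 263424 & \texttt{000000001 010100000 100110000}\\ 16 & 4 & 444528 & \texttt{000000000 000001010 001010100}\\ 17 & 4 & 592704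 & \texttt{000000000 000001010 100010011}\\ 18 & 4 & 1185408 & \texttt{000000001 000001010 100000000}\\ 19 & 4 & 1778112 & \texttt{000000000 000001010 001100000}\\ 20 & 4 & 1778112 & \texttt{000000001 000000010 001100000}\\ 21 & 4 & 1778112 & \texttt{000000001 000010000 011100100}\\ 22 & 4 & 2370816 & \texttt{000000001 010100000 100110010}\\ 23 & 4 & 2370816 & \texttt{000000001 010100000 100111010}\\ 24 & 4 & 3556224 & \texttt{000000001 000001010 100000010}\\ 25 & 4 & 4741632 & \texttt{000000001 000010000 100000010}\\ 26 & 4 & 4741632 & \texttt{000000001 000010100 100001000}\\ 27 & 4 & 7112448 & \texttt{000000001 000001010 100010000}\\ 28 & 4 & 7112448 & \texttt{000000001 000010000 100001010}\\ 29 & 4 & 7112448 & \texttt{000000001 000010100 011100000}\\ 30 & 5 & 28224 & \texttt{000001010 001000100 010100000}\\ 31 & 5 & 148176 & \texttt{000000001 000000010 001010100}\\ 32 & 5 & 148176 & \texttt{000000001 000001010 001010100}\\ 33 & 5 & 169344 & \texttt{000000000 001010100 010100011}\\ 34 & 5 & 592704 & \texttt{000001010 001000100 010110011}\\ 35 & 5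 & 1185408 & \texttt{000001010 001000100 010100010}\\ 36 & 5 & 1580544 & \texttt{000001010 001000100 100110000}\\ 37 & 5 & 1580544 & \texttt{000001010 001000100 100110001}\\ 38 & 5 & 1778112 & \texttt{000000001 000001010 001100000}\\ 39 & 5 & 1778112 & \texttt{000000001 000010100 001100110}\\ 40 & 5 & 2370816 & \texttt{000001010 001000100 010110100}\\ 41 & 5 & 2370816 & \texttt{000001010 001010100 100100001}\\ 42 & 5 & 2370816 & \texttt{000001010 001010100 100100101}\\ 43 & 5 & 3556224 & \texttt{000000001 000001010 010100000}\\ 44 & 5 & 4741632 & \texttt{000000001 010100000 100111100}\\ 45 & 5 & 4741632 & \texttt{000001010 001010100 010100100}\\ 46 & 5 & 4741632 & \texttt{000001010 001010100 100000010}\\ 47 & 5 & 4741632 & \texttt{000001010 001010100 100000011}\\ 48 & 5 & 4741632 & \texttt{000001010 001010100 100100010}\\ 49 & 5 & 4741632 & \texttt{000001010 001010100 100100110}\\ 50 & 5 & 7112448 & \texttt{000000001 001010100 100001010}\\ 51 & 5 & 14224896 & \texttt{000000001 000010100 100001010}\\ 52 & 5 & 14224896 & \texttt{000000001 001010100 010100000}\\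 53 & 6 & 32256 & \texttt{001010100 010100011 100011110}\\ 54 & 6 & 197568 & \texttt{000001010 001000100 010100001}\\ 55 & 6 & 395136 & \texttt{000001010 001010100 010100011}\\ \end{array}$$ For each rank $r=0,\dots,6$ the numbers of small orbits, of large orbits and of tensors of rank $r$ (including the zero tensor) are: $$\begin{array}{lrrrrrrr} \text{rank} & 0&1&2&3&4&5&6\\ \hline \text{small orbits} & 1&1&4&18&44&45&3\\ \text{large orbits} & 1&1&2&8&18&23&3\\ \text{tensors} & 1&343&43218&2372286&47506872&83670048&624960 \end{array}$$ In particular there are tensors of rank 6: they form three large orbits, with 624960 elements in all, represented by the canonical forms 53, 54 and 55 of the table. -/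

import Mathlib

open scoped BigOperators

namespace TensorsF2

/-- `3 × 3 × 3` tensors over the field with two elements.  An index `i : Fin 3 → Fin 3` lists the
three subscripts `(i 0, i 1, i 2)`, one for each direction, each in `{0, 1, 2}`. -/
abbrev Tensor : Type := (Fin 3 → Fin 3) → ZMod 2

/-- The outer product `a ⊗ b ⊗ c`, with `ijk` entry `a i * b j * c k`. -/
def outer (a b c : Fin 3 → ZMod 2) : Tensor := fun i => a (i 0) * b (i 1) * c (i 2)

/-- A simple tensor is an outer product of nonzero vectors. -/
def IsSimple (X : Tensor) : Prop :=
  ∃ a b c : Fin 3 → ZMod 2, a ≠ 0 ∧ b ≠ 0 ∧ c ≠ 0 ∧ X = outer a b c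

/-- The rank: the least `n` for which `X` is a sum of `n` simple tensors. -/
noncomputable def rank (X : Tensor) : ℕ :=
  sInf {n : ℕ | ∃ S : Fin n → Tensor, (∀ l, IsSimple (S l)) ∧ X = ∑ l, S l}

/-- The direct product of three copies of `GL₃(𝔽₂)`, one for each direction. -/
abbrev GL3Cubed : Type := Fin 3 → Matrix.GeneralLinearGroup (Fin 3) (ZMod 2)

/-- Change of basis in each direction:
`((A, B, C) • X) i₁ j₁ k₁ = ∑ i₂ j₂ k₂, A i₁ i₂ * B j₁ j₂ * C k₁ k₂ * X i₂ j₂ k₂`. -/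
def changeBasis (A : GL3Cubed) (X : Tensor) : Tensor := fun i =>
  ∑ j : Fin 3 → Fin 3,
    (A 0).val (i 0) (j 0) * (A 1).val (i 1) (j 1) * (A 2).val (i 2) (j 2) * X j

theorem changeBasis_apply (A : GL3Cubed) (X : Tensor) (i : Fin 3 → Fin 3) :
    changeBasis A X i = ∑ j : Fin 3 → Fin 3, (∏ d, (A d).val (i d) (j d)) * X j := by
  simp [changeBasis, Fin.prod_univ_three]

theorem changeBasis_one (X : Tensor) : changeBasis 1 X = X := by
  funext i
  rw [changeBasis_apply, Finset.sum_eq_single i]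
  · simp
  · intro j _ hj
    obtain ⟨d, hd⟩ := Function.ne_iff.mp hj
    rw [Finset.prod_eq_zero (Finset.mem_univ d), zero_mul]
    simp [Ne.symm hd]
  · simp

theorem changeBasis_mul (A B : GL3Cubed) (X : Tensor) :
    changeBasis (A * B) X = changeBasis A (changeBasis B X) := by
  funext i
  simp only [changeBasis_apply, Pi.mul_apply, Units.val_mul, Matrix.mul_apply, Finset.mul_sum]
  rw [Finset.sum_comm]
  refine Finset.sum_congr rfl fun j _ => ?_
  rw [Finset.prod_univ_sum, Finset.sum_mul]
  simp only [Fintype.piFinset_univ, Finset.prod_mul_distrib, mul_assoc]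

/-- `GL₃(𝔽₂)³` acts on tensors by change of basis in each direction. -/
instance : MulAction GL3Cubed Tensor where
  smul := changeBasis
  one_smul := changeBasis_one
  mul_smul := changeBasis_mul

/-- Permutation of the three directions. -/
def permute (δ : Equiv.Perm (Fin 3)) (X : Tensor) : Tensor := fun i => X (i ∘ δ)

/-- The group `GL₃(𝔽₂)³ ⋊ S₃`, in which `S₃` permutes the three factors:
`mulAutArrow δ A = A ∘ δ⁻¹`. -/
abbrev FullGroup : Type := GL3Cubed ⋊[mulAutArrow] Equiv.Perm (Fin 3)

theorem permute_changeBasis (δ : Equiv.Perm (Fin 3)) (A : GL3Cubed) (X : Tensor) :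
    permute δ (changeBasis A X) =
      changeBasis ((mulAutArrow δ : MulAut GL3Cubed) A) (permute δ X) := by
  funext i
  simp only [permute, changeBasis_apply]
  refine Fintype.sum_equiv (Equiv.arrowCongr δ (Equiv.refl (Fin 3))) _ _ fun j => ?_
  congr 1
  · refine Fintype.prod_equiv δ _ _ fun d => ?_
    change _ = (A (δ⁻¹ (δ d))).val _ (j (δ.symm (δ d)))
    simp
  · congr 1
    funext d
    simp [Equiv.arrowCongr]

/-- `GL₃(𝔽₂)³ ⋊ S₃` acts on tensors: permute the directions, then change bases. -/
instance : MulAction FullGroup Tensor where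
  smul g X := changeBasis g.left (permute g.right X)
  one_smul X := changeBasis_one X
  mul_smul g h X := by
    change changeBasis (g.left * mulAutArrow g.right h.left) (permute (g.right * h.right) X) =
      changeBasis g.left (permute g.right (changeBasis h.left (permute h.right X)))
    rw [changeBasis_mul, permute_changeBasis]
    rfl

/-- The position, from the right, of the entry with index `i` in the flattening
`[x₀₀₀, x₀₀₁, …, x₂₂₂]`, in which the entries are in lexicographic order of their subscripts. -/
def place (i : Fin 3 → Fin 3) : ℕ := 26 - (9 * (i 0).val + 3 * (i 1).val + (i 2).val)

/-- The non-negative integer whose binary representation is the flattening of `X`.  Tensors are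
compared through these integers, that is, by the lexicographic order on flattenings. -/
def encode (X : Tensor) : ℕ := ∑ i : Fin 3 → Fin 3, (X i).val * 2 ^ place i

/-- The tensor with a given encoding `n < 2 ^ 27`. -/
def decode (n : ℕ) : Tensor := fun i => if n.testBit (place i) then 1 else 0

/-- `X` is the canonical form of its orbit under `GL₃(𝔽₂)³ ⋊ S₃`: the minimal element of it. -/
def IsCanonicalForm (X : Tensor) : Prop :=
  ∀ Y ∈ MulAction.orbit FullGroup X, encode X ≤ encode Y

/-- A row of the table: the rank and the size of an orbit, and the encoding of its canonical form
(its binary digits are the entries of the flattening). -/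
structure Row where
  rank : ℕ
  size : ℕ
  code : ℕ

/-- The table of the 55 large orbits of nonzero tensors.  The comment after each row repeats the
flattening of the canonical form, that is, the 27 binary digits of the third entry. -/
def table : List Row := [
  ⟨1, 343, 1⟩, -- 000000000 000000000 000000001
  ⟨2, 6174, 10⟩, -- 000000000 000000000 000001010
  ⟨2, 37044, 528⟩, -- 000000000 000000001 000010000
  ⟨3, 3528, 84⟩, -- 000000000 000000000 001010100
  ⟨3, 4116, 5139⟩, -- 000000000 000001010 000010011
  ⟨3, 18522, 522⟩, -- 000000000 000000001 000001010
  ⟨3, 148176, 5140⟩, -- 000000000 000001010 000010100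
  ⟨3, 222264, 532⟩, -- 000000000 000000001 000010100
  ⟨3, 592704, 672⟩, -- 000000000 000000001 010100000
  ⟨3, 592704, 5378⟩, -- 000000000 000001010 100000010
  ⟨3, 790272, 270592⟩, -- 000000001 000010000 100000000
  ⟨4, 148176, 5188⟩, -- 000000000 000001010 001000100
  ⟨4, 197568, 2656434⟩, -- 000001010 001000100 010110010
  ⟨4, 222264, 596⟩, -- 000000000 000000001 001010100
  ⟨4, 263424, 344368⟩, -- 000000001 010100000 100110000
  ⟨4, 444528, 5204⟩, -- 000000000 000001010 001010100
  ⟨4, 592704, 5395⟩, -- 000000000 000001010 100010011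
  ⟨4, 1185408, 267520⟩, -- 000000001 000001010 100000000
  ⟨4, 1778112, 5216⟩, -- 000000000 000001010 001100000
  ⟨4, 1778112, 263264⟩, -- 000000001 000000010 001100000
  ⟨4, 1778112, 270564⟩, -- 000000001 000010000 011100100
  ⟨4, 2370816, 344370⟩, -- 000000001 010100000 100110010
  ⟨4, 2370816, 344378⟩, -- 000000001 010100000 100111010
  ⟨4, 3556224, 267522⟩, -- 000000001 000001010 100000010
  ⟨4, 4741632, 270594⟩, -- 000000001 000010000 100000010
  ⟨4, 4741632, 272648⟩, -- 000000001 000010100 100001000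
  ⟨4, 7112448, 267536⟩, -- 000000001 000001010 100010000
  ⟨4, 7112448, 270602⟩, -- 000000001 000010000 100001010
  ⟨4, 7112448, 272608⟩, -- 000000001 000010100 011100000
  ⟨5, 28224, 2656416⟩, -- 000001010 001000100 010100000
  ⟨5, 148176, 263252⟩, -- 000000001 000000010 001010100
  ⟨5, 148176, 267348⟩, -- 000000001 000001010 001010100
  ⟨5, 169344, 43171⟩, -- 000000000 001010100 010100011
  ⟨5, 592704, 2656435⟩, -- 000001010 001000100 010110011
  ⟨5, 1185408, 2656418⟩, -- 000001010 001000100 010100010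
  ⟨5, 1580544, 2656560⟩, -- 000001010 001000100 100110000
  ⟨5, 1580544, 2656561⟩, -- 000001010 001000100 100110001
  ⟨5, 1778112, 267360⟩, -- 000000001 000001010 001100000
  ⟨5, 1778112, 272486⟩, -- 000000001 000010100 001100110
  ⟨5, 2370816, 2656436⟩, -- 000001010 001000100 010110100
  ⟨5, 2370816, 2664737⟩, -- 000001010 001010100 100100001
  ⟨5, 2370816, 2664741⟩, -- 000001010 001010100 100100101
  ⟨5, 3556224, 267424⟩, -- 000000001 000001010 010100000
  ⟨5, 4741632, 344380⟩, -- 000000001 010100000 100111100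
  ⟨5, 4741632, 2664612⟩, -- 000001010 001010100 010100100
  ⟨5, 4741632, 2664706⟩, -- 000001010 001010100 100000010
  ⟨5, 4741632, 2664707⟩, -- 000001010 001010100 100000011
  ⟨5, 4741632, 2664738⟩, -- 000001010 001010100 100100010
  ⟨5, 4741632, 2664742⟩, -- 000001010 001010100 100100110
  ⟨5, 7112448, 305418⟩, -- 000000001 001010100 100001010
  ⟨5, 14224896, 272650⟩, -- 000000001 000010100 100001010
  ⟨5, 14224896, 305312⟩, -- 000000001 001010100 010100000
  ⟨6, 32256, 22103838⟩, -- 001010100 010100011 100011110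
  ⟨6, 197568, 2656417⟩, -- 000001010 001000100 010100001
  ⟨6, 395136, 2664611⟩] -- 000001010 001010100 010100011

/-- The orbits of a group that contain a nonzero tensor. -/
def nonzeroOrbits (Γ : Type) [Group Γ] [MulAction Γ Tensor] : Set (Set Tensor) :=
  {O | ∃ X : Tensor, X ≠ 0 ∧ O = MulAction.orbit Γ X}

/-- The orbits of a group that contain a tensor of rank `r`. -/
def orbitsOfRank (Γ : Type) [Group Γ] [MulAction Γ Tensor] (r : ℕ) : Set (Set Tensor) :=
  {O | ∃ X : Tensor, rank X = r ∧ O = MulAction.orbit Γ X}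

end TensorsF2

/-!
Write a tensor as the 27-bit number that encodes it.  A transvection adds one slice of the tensor to
another one, which on encodings is an exclusive or with a shifted and masked copy, and a permutation
of the directions moves bits by fixed distances.  Group elements are thus given as words in the 18
transvections, preceded by a permutation, and all computations are bit operations on natural
numbers, evaluated by the kernel.

*Every orbit has its minimum in the table.*  A tensor is minimal in its large orbit only if no word
lowers its encoding.  Every matrix of 9 bits other than 0, 1, 10, 84 is lowered by a word that acts
on rows and columns, so a minimal tensor has one of these four as its first slice; among the pairs
of leading slices that begin with one of them only 24 cannot be lowered; and of the `24 * 512`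
tensors that extend these pairs, only zero and the table entries survive
(`exists_row_code_eq`, `exists_row_isMin_orbit`).  Words that act on the leading slices alone do not
depend on the remaining bits (`act_shiftRight`), which is what allows the search to be cut off.

*Sizes and distinctness.*  Chains of stabilizers bound the order of each stabilizer in
`GL₃(𝔽₂)³` from below (`chainOrder_le`), hence the orbits from above; the symmetries of a table
entry show that its large orbit is a union of one or of three small ones (`exists_smallCode`).
These upper bounds add up to `2 ^ 27`, the number of all tensors, and the orbits cover everything.
So all bounds are equalities and no two of the listed orbits coincide (`Covers.ncard_eq`,
`Covers.index_unique`).  This holds for the large and for the small orbits alike.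

*Ranks.*  Give a tensor the rank that the table assigns to its orbit as a label.  Each entry becomes
an entry of label one less by adding a simple tensor, so the rank is at most the label.  For the
converse the label must not grow by more than one when a simple tensor is added
(`HasLabel.le_succ`).  This is checked for representatives of the labels up to 3, and for label 6 it
is checked that adding a simple tensor never leads below label 5; by symmetry this settles label 4,
and the labels 5 and 6 need no check.  Modulo the stabilizer of the representative only few simple
tensors remain.
-/

namespace TensorsF2

/-! ### Group elements acting on encodings -/

/-- The distance between the places of two entries whose index in direction `d` differs by one and
whose other indices agree.

Here and below, functions that the kernel evaluates many times are written with the operations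
`Nat.xor`, `Nat.land`, … themselves, which spares it the unfolding of notation classes. -/
def stride (d : ℕ) : ℕ := Nat.pow 3 (Nat.sub 2 d)

/-- The set of places of the entries with index 2 in direction `d`, as a bit mask. -/
def lastSlice (d : ℕ) : ℕ :=
  match d with
  | 0 => 511
  | 1 => 1838599
  | _ => 19173961

/-- Add slice `j` to slice `i` in direction `d`: slice `j` is moved to the places of slice 2, all
other bits are masked out, and the result is moved on to the places of slice `i`. -/
def addSlice (d i j x : ℕ) : ℕ :=
  Nat.xor x (Nat.shiftLeft
    (Nat.land (Nat.shiftRight x (Nat.mul (stride d) (Nat.sub 2 j))) (lastSlice d))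
    (Nat.mul (stride d) (Nat.sub 2 i)))

theorem testBit_addSlice_aux (d i j x p : ℕ) :
    (addSlice d i j x).testBit p = (x.testBit p ^^ (decide (stride d * (2 - i) ≤ p) &&
      (x.testBit (stride d * (2 - j) + (p - stride d * (2 - i))) &&
        (lastSlice d).testBit (p - stride d * (2 - i))))) := by
  change (x ^^^ (((x >>> (stride d * (2 - j))) &&& lastSlice d) <<< (stride d * (2 - i)))).testBit p
    = _
  simp only [Nat.testBit_xor, Nat.testBit_shiftLeft, Nat.testBit_and, Nat.testBit_shiftRight,
    ge_iff_le]

theorem lastSlice_testBit : ∀ (d i : Fin 3) (q : Fin 3 → Fin 3),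
    (decide (stride d * (2 - i.val) ≤ place q) &&
      (lastSlice d).testBit (place q - stride d * (2 - i.val))) = decide (q d = i) := by
  decide +kernel

theorem place_update : ∀ (d j : Fin 3) (q : Fin 3 → Fin 3),
    stride d * (2 - j.val) + (place q - stride d * (2 - (q d).val)) =
      place (Function.update q d j) := by
  decide +kernel

theorem testBit_addSlice (d i j : Fin 3) (x : ℕ) (q : Fin 3 → Fin 3) :
    (addSlice d i j x).testBit (place q) =
      (x.testBit (place q) ^^ (decide (q d = i) && x.testBit (place (Function.update q d j)))) := by
  rw [testBit_addSlice_aux, ← place_update d j q, ← lastSlice_testBit d i q]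
  by_cases h : q d = i
  · subst h
    rw [Bool.and_left_comm, Bool.and_comm]
  · have := lastSlice_testBit d i q
    simp only [h, decide_false] at this
    rw [Bool.and_left_comm, this]
    simp

theorem changeBasis_mulSingle (d : Fin 3) (u : Matrix.GeneralLinearGroup (Fin 3) (ZMod 2))
    (X : Tensor) (q : Fin 3 → Fin 3) :
    changeBasis (Pi.mulSingle d u) X q = ∑ s, u.val (q d) s * X (Function.update q d s) := by
  rw [changeBasis_apply]
  symm
  refine Fintype.sum_of_injective (Function.update q d) (Function.update_injective q d) _ _ ?_ ?_
  · intro r hr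
    have : ∃ e, e ≠ d ∧ q e ≠ r e := by
      by_contra! h
      refine hr ⟨r d, ?_⟩
      funext e
      by_cases he : e = d
      · subst he; simp
      · simp [he, h e he]
    obtain ⟨e, he, hqr⟩ := this
    rw [Finset.prod_eq_zero (Finset.mem_univ e), zero_mul]
    simp [he, hqr]
  · intro s
    congr 1
    rw [Finset.prod_eq_single d]
    · simp
    · intro e _ he
      simp [he]
    · simp

theorem exists_addSlice (d i j : Fin 3) (hij : i ≠ j) :
    ∃ g : GL3Cubed, ∀ x, decode (addSlice d i j x) = g • decode x := by
  have hT : Matrix.transvection i j (1 : ZMod 2) * Matrix.transvection i j 1 = 1 := by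
    rw [Matrix.transvection_mul_transvection_same _ _ hij]
    have : (1 : ZMod 2) + 1 = 0 := by decide
    rw [this, Matrix.transvection_zero]
  refine ⟨Pi.mulSingle d ⟨_, _, hT, hT⟩, fun x => ?_⟩
  funext q
  change _ = changeBasis _ _ _
  rw [changeBasis_mulSingle]
  simp only [Matrix.transvection, Matrix.add_apply, Matrix.one_apply, add_mul, ite_mul, one_mul,
    zero_mul, Finset.sum_add_distrib, Finset.sum_ite_eq, Finset.mem_univ, if_true,
    Function.update_eq_self]
  rw [Finset.sum_eq_single j]
  · simp only [decode, testBit_addSlice, Matrix.single_apply, and_true]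
    by_cases h : q d = i
    · simp only [h, decide_true, Bool.true_and, if_true, one_mul]
      cases x.testBit (place q) <;> cases x.testBit (place (Function.update q d j)) <;> decide
    · simp [h, Ne.symm h]
  · intro s _ hs
    simp [Ne.symm hs]
  · simp

/-- The direction in which the letter `k` acts. -/
def direction (k : ℕ) : ℕ := Nat.mod k 3

/-- The slice that the letter `k` changes. -/
def target (k : ℕ) : ℕ := Nat.mod (Nat.div k 3) 3

/-- The slice that the letter `k` adds to its target; it is never the target itself, so that every
natural number is a valid letter. -/
def source (k : ℕ) : ℕ :=
  Nat.mod (Nat.add (Nat.div k 3) (Nat.add 1 (Nat.mod (Nat.div k 9) 2))) 3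

/-- The transvection with number `k`.  The numbers below 18 give each of the 18 transvections once,
and 18 has the same effect as 0. -/
def transvect (k x : ℕ) : ℕ := addSlice (direction k) (target k) (source k) x

theorem exists_transvect (k : ℕ) : ∃ g : GL3Cubed, ∀ x, decode (transvect k x) = g • decode x :=
  exists_addSlice ⟨k % 3, by omega⟩ ⟨k / 3 % 3, by omega⟩
    ⟨(k / 3 + (1 + k / 9 % 2)) % 3, by omega⟩ (by
      intro h
      have := congrArg Fin.val h
      simp only at this
      omega)

/-- Apply the word `w`, whose letters are the base 32 digits of `w`, least significant digit first.
The first argument bounds the number of letters that are read.  Since 0 ends a word, a last letter 0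
is written as 18. -/
def act : ℕ → ℕ → ℕ → ℕ
  | 0, _, x => x
  | f + 1, w, x => cond (Nat.beq w 0) x
      (act f (Nat.shiftRight w 5) (transvect (Nat.land w 31) x))

theorem exists_act (f w : ℕ) : ∃ g : GL3Cubed, ∀ x, decode (act f w x) = g • decode x := by
  induction f generalizing w with
  | zero => exact ⟨1, fun x => (one_smul _ _).symm⟩
  | succ f ih =>
    obtain ⟨g, hg⟩ := ih (Nat.shiftRight w 5)
    obtain ⟨t, ht⟩ := exists_transvect (Nat.land w 31)
    rw [show act (f + 1) w = fun x => cond (Nat.beq w 0) x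
      (act f (Nat.shiftRight w 5) (transvect (Nat.land w 31) x)) from rfl]
    cases Nat.beq w 0
    · exact ⟨g * t, fun x => by simp only [cond_false, hg, ht, mul_smul]⟩
    · exact ⟨1, fun x => (one_smul _ _).symm⟩

/-- Exchange each bit selected by `m` with the bit `s` places above it, likewise for `m'` and `s'`,
and keep the bits selected by `fixed`. -/
def swapDirs (s m s' m' fixed x : ℕ) : ℕ :=
  Nat.lor (Nat.land x fixed)
    (Nat.lor
      (Nat.lor (Nat.land (Nat.shiftRight x s) m) (Nat.shiftLeft (Nat.land x m) s))
      (Nat.lor (Nat.land (Nat.shiftRight x s') m') (Nat.shiftLeft (Nat.land x m') s')))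

theorem testBit_swapDirs (s m s' m' fixed x p : ℕ) :
    (swapDirs s m s' m' fixed x).testBit p =
      (x.testBit p && fixed.testBit p ||
        (x.testBit (s + p) && m.testBit p ||
            (decide (s ≤ p) && m.testBit (p - s)) && x.testBit (p - s) ||
          (x.testBit (s' + p) && m'.testBit p ||
            (decide (s' ≤ p) && m'.testBit (p - s')) && x.testBit (p - s')))) := by
  change ((x &&& fixed) ||| (((x >>> s) &&& m ||| (x &&& m) <<< s) |||
    ((x >>> s') &&& m' ||| (x &&& m') <<< s'))).testBit p = _
  simp only [Nat.testBit_or, Nat.testBit_shiftLeft, Nat.testBit_and, Nat.testBit_shiftRight,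
    ge_iff_le, Bool.and_assoc, Bool.and_comm (x.testBit (p - s)),
    Bool.and_comm (x.testBit (p - s'))]

/-- The masks fit the permutation `δ` as soon as every place is sent to the one prescribed by exactly
the masks that select it. -/
theorem decode_swapDirs (s m s' m' fixed : ℕ) (δ : Equiv.Perm (Fin 3))
    (h : ∀ q : Fin 3 → Fin 3,
      (fixed.testBit (place q) = decide (place (q ∘ δ) = place q)) ∧
      (m.testBit (place q) = decide (place (q ∘ δ) = s + place q)) ∧
      ((decide (s ≤ place q) && m.testBit (place q - s)) =
        decide (s ≤ place q ∧ place (q ∘ δ) = place q - s)) ∧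
      (m'.testBit (place q) = decide (place (q ∘ δ) = s' + place q)) ∧
      ((decide (s' ≤ place q) && m'.testBit (place q - s')) =
        decide (s' ≤ place q ∧ place (q ∘ δ) = place q - s')) ∧
      (place (q ∘ δ) = place q ∨ place (q ∘ δ) = s + place q ∨
        (s ≤ place q ∧ place (q ∘ δ) = place q - s) ∨ place (q ∘ δ) = s' + place q ∨
        (s' ≤ place q ∧ place (q ∘ δ) = place q - s'))) (x : ℕ) :
    decode (swapDirs s m s' m' fixed x) = permute δ (decode x) := by
  funext q
  obtain ⟨h1, h2, h3, h4, h5, h6⟩ := h q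
  have : (swapDirs s m s' m' fixed x).testBit (place q) = x.testBit (place (q ∘ δ)) := by
    rw [testBit_swapDirs, h1, h2, h3, h4, h5]
    have aux : ∀ (P : Prop) [Decidable P] (r : ℕ), (P → place (q ∘ δ) = r) →
        (x.testBit r && decide P) = (x.testBit (place (q ∘ δ)) && decide P) := by
      intro P _ r hr
      by_cases hP : P
      · rw [hr hP]
      · simp [hP]
    rw [Bool.and_comm _ (x.testBit (place q - s)), Bool.and_comm _ (x.testBit (place q - s')),
      aux _ _ id, aux _ _ id, aux _ _ id, aux _ _ And.right, aux _ _ And.right]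
    simp only [← Bool.and_or_distrib_left, ← Bool.decide_or]
    rw [decide_eq_true, Bool.and_true]
    tauto
  simp [decode, permute, this]

/-- Exchange the first two directions.  An off-diagonal pair of indices `(0, 1)` or `(1, 2)` is
`9 - 3 = 6` places away from its mirror image, the pair `(0, 2)` is 12 places away. -/
def swap01 (x : ℕ) : ℕ := swapDirs 6 229432 12 448 117469191 x

/-- Exchange the last two directions. -/
def swap12 (x : ℕ) : ℕ := swapDirs 2 8930338 4 1050628 71705361 x

theorem decode_swap01 (x : ℕ) : decode (swap01 x) = permute (Equiv.swap 0 1) (decode x) :=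
  decode_swapDirs _ _ _ _ _ _ (by decide +kernel) x

theorem decode_swap12 (x : ℕ) : decode (swap12 x) = permute (Equiv.swap 1 2) (decode x) :=
  decode_swapDirs _ _ _ _ _ _ (by decide +kernel) x

/-- Permute the directions: the bits 0, 1, 2 of `p` say whether to apply `swap01`, `swap12`, and
`swap01` once more, in this order.  All six permutations arise. -/
def permAct (p x : ℕ) : ℕ :=
  let x := cond (Nat.testBit p 0) (swap01 x) x
  let x := cond (Nat.testBit p 1) (swap12 x) x
  cond (Nat.testBit p 2) (swap01 x) x

/-- Apply a word for the large group: the last three bits of `w` give a permutation of the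
directions, which is applied first, and the other bits a word in the transvections. -/
def fullAct (w x : ℕ) : ℕ := act 24 (Nat.shiftRight w 3) (permAct (Nat.land w 7) x)

/-- The permutation that `permAct p` applies. -/
def permOf (p : ℕ) : Equiv.Perm (Fin 3) :=
  (if p.testBit 2 then Equiv.swap 0 1 else 1) * ((if p.testBit 1 then Equiv.swap 1 2 else 1) *
    (if p.testBit 0 then Equiv.swap 0 1 else 1))

theorem permute_mul (δ ε : Equiv.Perm (Fin 3)) (X : Tensor) :
    permute (δ * ε) X = permute δ (permute ε X) := rfl

theorem permute_one (X : Tensor) : permute 1 X = X := rfl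

theorem decode_permAct (p x : ℕ) : decode (permAct p x) = permute (permOf p) (decode x) := by
  unfold permAct permOf
  cases p.testBit 0 <;> cases p.testBit 1 <;> cases p.testBit 2 <;>
    simp [← permute_mul, permute_one, decode_swap01, decode_swap12]

theorem exists_fullAct (w : ℕ) :
    ∃ g : FullGroup, ∀ x, decode (fullAct w x) = g • decode x := by
  obtain ⟨g, hg⟩ := exists_act 24 (Nat.shiftRight w 3)
  refine ⟨⟨g, permOf (Nat.land w 7)⟩, fun x => ?_⟩
  rw [fullAct, hg, decode_permAct]
  rfl

theorem lastSlice_lt (d : ℕ) : lastSlice d < 2 ^ 27 := by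
  unfold lastSlice
  split <;> decide

theorem addSlice_lt {d i j x : ℕ} (hd : d < 3) (hi : i < 3) (hx : x < 2 ^ 27) :
    addSlice d i j x < 2 ^ 27 := by
  refine Nat.lt_pow_two_of_testBit _ fun p hp => ?_
  rw [testBit_addSlice_aux, Nat.testBit_lt_two_pow (hx.trans_le (Nat.pow_le_pow_right two_pos hp))]
  have key : ∀ (d i : Fin 3) (t : Fin 27), (lastSlice d).testBit t = true →
      t.val + stride d * (2 - i.val) < 27 := by decide +kernel
  rw [Bool.false_xor, Bool.eq_false_iff]
  intro h
  simp only [Bool.and_eq_true, decide_eq_true_eq] at h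
  obtain ⟨h1, -, h2⟩ := h
  have h3 : p - stride d * (2 - i) < 27 := by
    by_contra h3
    rw [Nat.testBit_lt_two_pow ((lastSlice_lt d).trans_le
      (Nat.pow_le_pow_right two_pos (not_lt.mp h3)))] at h2
    exact absurd h2 (by decide)
  have := key ⟨d, hd⟩ ⟨i, hi⟩ ⟨_, h3⟩ h2
  simp only at this
  omega

theorem transvect_lt (k : ℕ) {x : ℕ} (hx : x < 2 ^ 27) : transvect k x < 2 ^ 27 :=
  addSlice_lt (d := direction k) (i := target k) (Nat.mod_lt _ (by decide))
    (Nat.mod_lt _ (by decide)) hx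

theorem act_lt (f w : ℕ) {x : ℕ} (hx : x < 2 ^ 27) : act f w x < 2 ^ 27 := by
  induction f generalizing w x with
  | zero => exact hx
  | succ f ih =>
    change cond _ _ _ < _
    cases Nat.beq w 0
    · exact ih _ (transvect_lt _ hx)
    · exact hx

theorem swapDirs_lt {s m s' m' fixed x : ℕ} (h : m <<< s < 2 ^ 27) (h' : m' <<< s' < 2 ^ 27)
    (hm : m < 2 ^ 27) (hm' : m' < 2 ^ 27) (hx : x < 2 ^ 27) :
    swapDirs s m s' m' fixed x < 2 ^ 27 := by
  have aux : ∀ m s, m <<< s < 2 ^ 27 → (x &&& m) <<< s < 2 ^ 27 := fun m s h =>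
    lt_of_le_of_lt (by
      rw [Nat.shiftLeft_eq, Nat.shiftLeft_eq]
      exact Nat.mul_le_mul_right _ Nat.and_le_right) h
  exact Nat.or_lt_two_pow (Nat.and_le_left.trans_lt hx)
    (Nat.or_lt_two_pow
      (Nat.or_lt_two_pow (Nat.and_lt_two_pow _ hm) (aux _ _ h))
      (Nat.or_lt_two_pow (Nat.and_lt_two_pow _ hm') (aux _ _ h')))

theorem permAct_lt (p : ℕ) {x : ℕ} (hx : x < 2 ^ 27) : permAct p x < 2 ^ 27 := by
  have h1 : ∀ x < 2 ^ 27, swap01 x < 2 ^ 27 := fun x hx =>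
    swapDirs_lt (by decide) (by decide) (by decide) (by decide) hx
  have h2 : ∀ x < 2 ^ 27, swap12 x < 2 ^ 27 := fun x hx =>
    swapDirs_lt (by decide) (by decide) (by decide) (by decide) hx
  unfold permAct
  cases p.testBit 0 <;> cases p.testBit 1 <;> cases p.testBit 2 <;>
    simp only [cond_true, cond_false] <;>
    first
    | exact h1 _ (h2 _ (h1 _ hx))
    | exact h2 _ (h1 _ hx)
    | exact h1 _ (h2 _ hx)
    | exact h1 _ (h1 _ hx)
    | exact h1 _ hx
    | exact h2 _ hx
    | exact hx

theorem fullAct_lt (w : ℕ) {x : ℕ} (hx : x < 2 ^ 27) : fullAct w x < 2 ^ 27 :=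
  act_lt _ _ (permAct_lt _ hx)

/-! ### Encodings, additivity and simple tensors -/

theorem place_injective : Function.Injective place := by
  intro q r h
  have : ∀ q r : Fin 3 → Fin 3, place q = place r → q = r := by decide +kernel
  exact this q r h

theorem exists_place_eq {p : ℕ} (hp : p < 27) : ∃ q, place q = p := by
  have : ∀ p : Fin 27, ∃ q, place q = p.val := by decide +kernel
  exact this ⟨p, hp⟩

theorem place_lt (q : Fin 3 → Fin 3) : place q < 27 := by
  unfold place
  omega

theorem testBit_encode (X : Tensor) (p : ℕ) :
    (encode X).testBit p = true ↔ ∃ q, X q = 1 ∧ place q = p := by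
  have h : encode X = ∑ p ∈ (Finset.univ.filter fun q => X q = 1).image place, 2 ^ p := by
    rw [Finset.sum_image place_injective.injOn, Finset.sum_filter, encode]
    refine Finset.sum_congr rfl fun q _ => ?_
    have : ∀ a : ZMod 2, a.val = if a = 1 then 1 else 0 := by decide
    rw [this]
    split <;> simp
  -- `encode X` is a sum of distinct powers of two, so its bits are the exponents
  rw [← Nat.mem_bitIndices, ← List.mem_toFinset, h, Finset.toFinset_bitIndices_sum_two_pow]
  simp

theorem encode_lt (X : Tensor) : encode X < 2 ^ 27 := by
  refine Nat.lt_pow_two_of_testBit _ fun p hp => ?_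
  rw [Bool.eq_false_iff]
  intro h
  obtain ⟨q, -, rfl⟩ := (testBit_encode X p).mp h
  exact absurd (place_lt q) (not_lt.mpr hp)

theorem decode_encode (X : Tensor) : decode (encode X) = X := by
  funext q
  have h : (encode X).testBit (place q) = true ↔ X q = 1 := by
    rw [testBit_encode]
    exact ⟨fun ⟨r, hr, hrq⟩ => place_injective hrq ▸ hr, fun h => ⟨q, h, rfl⟩⟩
  have : ∀ a : ZMod 2, a ≠ 1 → 0 = a := by decide
  unfold decode
  split
  · exact (h.mp ‹_›).symm
  · exact this _ (mt h.mpr ‹_›)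

theorem encode_decode {n : ℕ} (hn : n < 2 ^ 27) : encode (decode n) = n := by
  refine Nat.eq_of_testBit_eq fun p => ?_
  rw [Bool.eq_iff_iff, testBit_encode]
  constructor
  · rintro ⟨q, hq, rfl⟩
    by_contra h
    simp [decode, h] at hq
  · intro h
    obtain ⟨q, rfl⟩ := exists_place_eq (p := p) (by
      by_contra hp
      rw [Nat.testBit_lt_two_pow (hn.trans_le (Nat.pow_le_pow_right two_pos (not_lt.mp hp)))] at h
      exact absurd h (by decide))
    exact ⟨q, by simp [decode, h], rfl⟩

theorem decode_injOn {m n : ℕ} (hm : m < 2 ^ 27) (hn : n < 2 ^ 27) (h : decode m = decode n) :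
    m = n := by
  rw [← encode_decode hm, h, encode_decode hn]

theorem decode_xor (m n : ℕ) : decode (Nat.xor m n) = decode m + decode n := by
  funext q
  change (if (m ^^^ n).testBit (place q) then (1 : ZMod 2) else 0) = _
  rw [Nat.testBit_xor, Pi.add_apply, decode, decode]
  cases m.testBit (place q) <;> cases n.testBit (place q) <;> decide

theorem decode_zero : decode 0 = 0 := by
  funext q
  simp [decode]

theorem add_add_cancel_self (X S : Tensor) : X + S + S = X := by
  funext q
  have : ∀ a b : ZMod 2, a + b + b = a := by decide
  exact this _ _

theorem smul_add_tensor (A : GL3Cubed) (X Y : Tensor) : A • (X + Y) = A • X + A • Y := by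
  funext i
  change changeBasis A (X + Y) i = changeBasis A X i + changeBasis A Y i
  simp only [changeBasis, Pi.add_apply, mul_add, Finset.sum_add_distrib]

theorem full_smul_def (g : FullGroup) (X : Tensor) : g • X = g.left • permute g.right X := rfl

theorem full_smul_add (g : FullGroup) (X Y : Tensor) : g • (X + Y) = g • X + g • Y := by
  rw [full_smul_def, full_smul_def, full_smul_def, ← smul_add_tensor]
  rfl

theorem smul_zero_tensor (A : GL3Cubed) : A • (0 : Tensor) = 0 := by
  have := smul_add_tensor A 0 0
  simpa using this

theorem full_smul_zero (g : FullGroup) : g • (0 : Tensor) = 0 := by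
  have := full_smul_add g 0 0
  simpa using this

theorem full_smul_sum (g : FullGroup) {n : ℕ} (S : Fin n → Tensor) :
    g • ∑ l, S l = ∑ l, g • S l := by
  induction n with
  | zero => simp [full_smul_zero]
  | succ n ih => rw [Fin.sum_univ_succ, Fin.sum_univ_succ, full_smul_add, ih]

theorem isSimple_iff (X : Tensor) :
    IsSimple X ↔ ∃ v : Fin 3 → Fin 3 → ZMod 2, (∀ d, v d ≠ 0) ∧ X = fun i => ∏ d, v d (i d) := by
  constructor
  · rintro ⟨a, b, c, ha, hb, hc, rfl⟩
    refine ⟨![a, b, c], fun d => ?_, ?_⟩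
    · fin_cases d <;> assumption
    · funext i
      simp [Fin.prod_univ_three, outer]
  · rintro ⟨v, hv, rfl⟩
    refine ⟨v 0, v 1, v 2, hv 0, hv 1, hv 2, ?_⟩
    funext i
    simp [Fin.prod_univ_three, outer]

theorem IsSimple.full_smul {X : Tensor} (hX : IsSimple X) (g : FullGroup) : IsSimple (g • X) := by
  rw [isSimple_iff] at hX ⊢
  obtain ⟨v, hv, rfl⟩ := hX
  refine ⟨fun d => (g.left d).val.mulVec (v (g.right.symm d)), fun d h => ?_, ?_⟩
  · refine hv (g.right.symm d) ?_
    have := congrArg ((g.left d)⁻¹).val.mulVec h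
    rwa [Matrix.mulVec_mulVec, ← Units.val_mul, inv_mul_cancel, Units.val_one, Matrix.one_mulVec,
      Matrix.mulVec_zero] at this
  · funext i
    change changeBasis _ _ i = _
    rw [changeBasis_apply]
    simp only [Matrix.mulVec, dotProduct, Finset.prod_univ_sum, Fintype.piFinset_univ]
    refine Finset.sum_congr rfl fun j _ => ?_
    rw [Finset.prod_mul_distrib]
    congr 1
    exact (Equiv.prod_comp g.right.symm fun d => v d (j (g.right d))).symm.trans (by simp)

/-- The encodings of the simple tensors.  Spread out with the strides of the three directions, the
encodings of three vectors multiply without carries. -/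
def simpleCodes : List ℕ :=
  [1, 512, 513, 262144, 262145, 262656, 262657].flatMap fun a =>
    [1, 8, 9, 64, 65, 72, 73].flatMap fun b =>
      [1, 2, 3, 4, 5, 6, 7].map fun c => Nat.mul (Nat.mul a b) c

theorem IsSimple.encode_mem {X : Tensor} (hX : IsSimple X) : encode X ∈ simpleCodes := by
  obtain ⟨a, b, c, ha, hb, hc, rfl⟩ := hX
  have key : encode (outer a b c) =
      (∑ i, (a i).val * 2 ^ (9 * (2 - i.val))) * (∑ i, (b i).val * 2 ^ (3 * (2 - i.val))) *
        ∑ i, (c i).val * 2 ^ (2 - i.val) := by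
    have hval : ∀ x y : ZMod 2, (x * y).val = x.val * y.val := by decide
    have hp : ∀ i : Fin 3 → Fin 3, place i =
        9 * (2 - (i 0).val) + 3 * (2 - (i 1).val) + (2 - (i 2).val) := fun i => by
      unfold place
      omega
    have := Finset.prod_univ_sum (R := ℕ) (fun _ : Fin 3 => (Finset.univ : Finset (Fin 3)))
      fun d i => ![(a i).val * 2 ^ (9 * (2 - i.val)), (b i).val * 2 ^ (3 * (2 - i.val)),
        (c i).val * 2 ^ (2 - i.val)] d
    simp only [Fin.prod_univ_three, Fintype.piFinset_univ, Matrix.cons_val] at this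
    rw [this, encode]
    refine Finset.sum_congr rfl fun i _ => ?_
    rw [outer, hval, hval, hp, pow_add, pow_add]
    ring
  have h9 : ∀ a : Fin 3 → ZMod 2, a ≠ 0 → (∑ i, (a i).val * 2 ^ (9 * (2 - i.val))) ∈
      [1, 512, 513, 262144, 262145, 262656, 262657] := by decide +kernel
  have h3 : ∀ a : Fin 3 → ZMod 2, a ≠ 0 → (∑ i, (a i).val * 2 ^ (3 * (2 - i.val))) ∈
      [1, 8, 9, 64, 65, 72, 73] := by decide +kernel
  have h1 : ∀ a : Fin 3 → ZMod 2, a ≠ 0 → (∑ i, (a i).val * 2 ^ (2 - i.val)) ∈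
      [1, 2, 3, 4, 5, 6, 7] := by decide +kernel
  rw [key]
  exact List.mem_flatMap.mpr ⟨_, h9 a ha, List.mem_flatMap.mpr ⟨_, h3 b hb,
    List.mem_map.mpr ⟨_, h1 c hc, rfl⟩⟩⟩

theorem isSimple_decode_one : IsSimple (decode 1) :=
  ⟨![0, 0, 1], ![0, 0, 1], ![0, 0, 1], by decide, by decide, by decide, by decide +kernel⟩

/-! ### Minimal elements of orbits -/

/-- Data that certify a row of the table with encoding `n`.
* `peel` encodes a simple tensor whose sum with the canonical form has rank one less.
* `symmetries` are words in the format of `fullAct` that fix `n` and permute the directions: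
  two transpositions if every permutation extends to a symmetry, one transposition otherwise.
* `chain` lists base points, each with words in the transvections, in the format of `act`, that fix
  `n` and all earlier base points and take the base point to the other points of its orbit, in
  increasing order. -/
structure Certificate where
  peel : ℕ
  symmetries : List ℕ
  chain : List (ℕ × List ℕ)

/-- Words in row and column operations that lower the first slice of a tensor, in the format
of `fullAct`. -/
def headWords : List ℕ := [
  8, 64, 128, 56, 112, 136, 2616, 624, 1416, 360, 1152]

/-- Further words that lower the pair of the first two slices, without use of the third one. -/
def pairWords : List ℕ := [
  96, 144, 104, 544, 2104, 2896, 4704, 1312, 1288, 3712, 2816, 3424, 256, 4480, 82176, 83712,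
  82016, 67424, 2678880, 1451136, 2927112]

/-- Further words for the large group that lower the tensors which extend a minimal pair. -/
def tensorWords : List ℕ := [
  48, 120, 49, 50, 26, 98, 74, 122, 17, 888, 625, 522, 2634, 4456, 2152, 2633, 1417, 1422, 1888,
  118112, 67448, 17432, 68984, 42008, 16640, 118882, 143408, 116777, 369528, 2681138, 4589408,
  2631985, 639336, 2158386, 3804978, 4220440, 2158384, 2679672, 4548625, 1345305, 2681137, 369529,
  4477049, 2139142, 146804481, 120849920, 119654192, 46402608, 70642736, 96813384, 146861920,
  67899139, 1486131234, 3022580022, 1485964153, 654680160, 1485080857, 2996914462, 1485963366,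
  98335566177, 3109884600416, 672835339128]

/-- The pairs of leading slices, as numbers of 18 bits, that the words for pairs cannot lower. -/
def minimalPairs : List ℕ := [
  0, 1, 10, 84, 514, 520, 522, 528, 532, 592, 596, 672, 5139, 5140, 5188, 5200, 5204, 5216, 5377,
  5378, 5395, 43171, 43173, 43266]

/-- The certificates for the rows of the table, in the same order. -/
def certificates : List Certificate := [
  ⟨1, [1, 2], [(2, [17, 450, 14882, 2, 258]), (4, [8, 14, 456]), (8, [16, 417, 13825, 1, 513]),
    (64, [7, 13, 423]), (512, [15, 384, 12480, 18, 192]), (262144, [6, 12, 390])]⟩,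
  ⟨2, [2], [(1, [562692, 164]), (2, [560]), (4, [8, 14, 456]), (64, [7, 13, 423]), (512, [15, 384,
    12480, 18, 192]), (262144, [6, 12, 390])]⟩,
  ⟨16, [45353, 2], [(1, [6087193529827]), (4, [8, 14, 456]), (64, [7, 13, 423]), (262144, [6, 12,
    390])]⟩,
  ⟨4, [2], [(1, [562593, 161, 461316, 68, 180760353921, 383860865, 270703745, 70785, 592875494721,
    575744417, 273751076, 165924, 273642, 280042820, 362, 568746, 280141121, 582137153, 365889,
    487965098]), (2, [557]), (8, [464]), (4, [263]), (512, [15, 384, 12768, 18, 480]), (262144,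
    [6, 12, 390])]⟩,
  ⟨1, [1, 122], [(1, [562692, 5263, 562659, 5635, 528495, 147939, 5805187, 186126819]), (2,
    [17935]), (4, [8, 14, 456]), (64, [7, 13, 423]), (262144, [6, 12, 390])]⟩,
  ⟨2, [1, 2], [(2, [559]), (8, [527]), (4, [8, 14, 456]), (64, [7, 13, 423]), (262144, [6, 12,
    390])]⟩,
  ⟨6, [1], [(1, [2427982307, 362627]), (2, [565775]), (64, [7, 13, 423]), (262144, [6, 12, 390])]⟩,
  ⟨4, [45353], [(8, [464]), (4, [271]), (64, [7, 13, 423]), (262144, [6, 12, 390])]⟩,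
  ⟨32, [2], [(2, [461217, 65]), (4, [461]), (262144, [6, 12, 390])]⟩,
  ⟨256, [122], [(27, [2619582691, 9182687301091]), (1, [5944524943]), (262144, [6, 12, 390])]⟩,
  ⟨256, [68417, 2], [(27, [2682254298595, 9182885681446]), (1, [6087193526656])]⟩,
  ⟨4, [2], [(1, [472286691, 2083]), (2, [560]), (512, [14767]), (4, [263]), (262144, [6, 12,
    390])]⟩,
  ⟨68290820, [113, 50], [(1, [599332633795, 464003]), (2, [573926]), (4, [8422, 14764,
    478584198])]⟩,
  ⟨4, [2], [(2, [557]), (8, [464]), (4, [263]), (64, [239]), (262144, [6, 12, 390])]⟩,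
  ⟨16, [19144689969, 122], [(1, [46563, 2467]), (512, [14767]), (2, [461217, 79917])]⟩,
  ⟨4, [2], [(512, [14767]), (2, [571824]), (4, [263]), (262144, [6, 12, 390])]⟩,
  ⟨1, [122], [(131072, [17935]), (1, [562692, 181392]), (262144, [6, 12, 390])]⟩,
  ⟨256, [1190281814524673, 2], [(2, [560]), (8, [524])]⟩,
  ⟨32, [1486131234], [(4, [269]), (262144, [6, 12, 390])]⟩,
  ⟨32, [19985], [(2, [556]), (4, [269]), (64, [230])]⟩,
  ⟨36, [2], [(1, [6087193526656]), (512, [275942]), (4, [467367])]⟩,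
  ⟨18, [3248000861808135], [(1, [2631402979, 81870883]), (4, [14767])]⟩,
  ⟨27, [122], [(1, [18775902567811, 84022920579]), (4, [14767])]⟩,
  ⟨256, [122], [(8, [524]), (2, [17798])]⟩,
  ⟨2, [68417, 48697548213250], []⟩,
  ⟨292, [68417, 21458034388762], []⟩,
  ⟨256, [2], [(2, [573926])]⟩,
  ⟨27, [2], [(1, [6087193526656])]⟩,
  ⟨216, [41], [(4, [15212006])]⟩,
  ⟨18, [1, 2], [(1, [576197091, 5251, 280209609, 11593, 8870417274883, 374673699]), (2, [17935,
    472286592, 15670631772352, 2080, 573048288]), (4, [8422, 14764, 478584198])]⟩,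
  ⟨4, [1], [(1, [576095616, 5152]), (8, [527]), (512, [463]), (4, [262]), (2, [17836]), (64,
    [230])]⟩,
  ⟨4, [1, 2], [(2, [17836]), (8, [14860]), (262144, [262]), (512, [14767]), (4, [263])]⟩,
  ⟨1, [2106], [(1, [610718660772068, 270703745, 406206273732644, 170132615, 499664827713,
    493426846119, 77692667363, 386630988911, 18729144803, 15218131055, 393259428323,
    199686778325697647, 2634262639, 15110512099, 603708166636655, 389507434392035, 76153069211759,
    490006283375, 290980331308418531, 194996357989859]), (262144, [6, 12, 390])]⟩,
  ⟨1, [113, 50], [(2, [573926]), (4, [8422, 14764, 478584198])]⟩,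
  ⟨16, [1, 50], [(4, [8422, 14764, 478584198])]⟩,
  ⟨16, [114945, 16642], [(2, [472286592, 81835020])]⟩,
  ⟨18, [114945, 16642], [(2, [472286592, 81835020])]⟩,
  ⟨32, [19985], [(2, [556]), (4, [269]), (64, [230])]⟩,
  ⟨2, [1], [(8, [14863]), (4, [275692]), (64, [230])]⟩,
  ⟨6, [3425, 122], [(2, [18104559])]⟩,
  ⟨5, [2059445705949953, 118114], [(2, [573676])]⟩,
  ⟨1, [2785030226689, 3813482], [(2, [573676])]⟩,
  ⟨32, [2], [(512, [8431]), (4, [461])]⟩,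
  ⟨4, [654847242], [(1, [18775893127651, 15979473243628])]⟩,
  ⟨384, [1, 3813482], []⟩,
  ⟨260, [50], [(1, [536510730040884987174, 529812645948200027337])]⟩,
  ⟨45, [720883452179058122777, 50], []⟩,
  ⟨6, [3779634], [(1, [536510729737784567174, 529812645735400779977])]⟩,
  ⟨2, [92745, 3828673586], []⟩,
  ⟨27, [2], [(1, [2682254298595])]⟩,
  ⟨2, [68417], []⟩,
  ⟨48, [2], []⟩,
  ⟨1, [1, 2106], [(7, [270703745, 599332631008, 499664827713, 170132615, 493426846119,
    84296416268, 270702688, 599329867235, 190438310281, 190422886883, 472388067, 81936495,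
    589562283119, 19318770551461984, 490012387439, 393268960739, 398855616132777443,
    19638628580884873, 77682944483, 37984352, 499664793888, 170131558, 493426812294, 84290223305,
    19318574157964483, 589556098432, 490000104649, 393274861030, 398855625597291712,
    19638425844223168, 77695421641, 239108198, 18866188401865, 6239873784908992, 6093837411814,
    6239979884809417, 16168610990948454, 16168594580156704, 15583759639747, 9083629608612128,
    15583558122697, 84101080259, 84094887296, 19178244613606, 19178455272649, 19542996735459430,
    560937283872, 564051551622]), (1, [2486165352928, 12372191656972])]⟩,
  ⟨1, [1, 2], [(2, [17935, 472286592, 15979878855136, 2080, 573048288]), (4, [8422, 14764,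
    478584198])]⟩,
  ⟨1, [1, 50], [(1, [18729144803, 15218131055]), (4, [8422, 14764, 478584198])]⟩]

/-- Whether `p` holds for all numbers below `n`. -/
def allBelow (n : ℕ) (p : ℕ → Bool) : Bool :=
  Nat.rec true (fun k ih => and (p k) ih) n

theorem allBelow_spec {n : ℕ} {p : ℕ → Bool} (h : allBelow n p = true) {k : ℕ} (hk : k < n) :
    p k = true := by
  induction n with
  | zero => exact absurd hk (Nat.not_lt_zero _)
  | succ n ih =>
    change (p n && allBelow n p) = true at h
    rw [Bool.and_eq_true] at h
    rcases Nat.lt_succ_iff_lt_or_eq.mp hk with hk | rfl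
    · exact ih h.2 hk
    · exact h.1

/-- Whether adding slice `j` to slice `i` in direction `d` leaves the bits from place `s` on
independent of the bits below `s`. -/
def isLocalLetter (s d i j : ℕ) : Bool :=
  allBelow 27 fun t => or (not (Nat.testBit (lastSlice d) t))
    (or (Nat.blt (Nat.add t (Nat.mul (stride d) (Nat.sub 2 i))) s)
      (Nat.ble s (Nat.add t (Nat.mul (stride d) (Nat.sub 2 j)))))

/-- Whether all letters of a word leave the bits from place `s` on independent of those below. -/
def isLocal (s : ℕ) : ℕ → ℕ → Bool
  | 0, _ => true
  | f + 1, w => cond (Nat.beq w 0) true (and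
      (isLocalLetter s (direction (Nat.land w 31)) (target (Nat.land w 31))
        (source (Nat.land w 31)))
      (isLocal s f (Nat.shiftRight w 5)))

/-- Whether one of the words lowers the number formed by the bits of `n` from place `s` on. -/
def lowers (s : ℕ) (ws : List ℕ) (n : ℕ) : Bool :=
  ws.any fun w => Nat.blt (Nat.shiftRight (fullAct w n) s) (Nat.shiftRight n s)

theorem addSlice_shiftRight {s d i j : ℕ} (h : isLocalLetter s d i j = true) {m n : ℕ}
    (hmn : m >>> s = n >>> s) : addSlice d i j m >>> s = addSlice d i j n >>> s := by
  have hbit : ∀ q, s ≤ q → m.testBit q = n.testBit q := fun q hq => by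
    have := congrArg (Nat.testBit · (q - s)) hmn
    simpa only [Nat.testBit_shiftRight, Nat.add_sub_cancel' hq] using this
  refine Nat.eq_of_testBit_eq fun p => ?_
  rw [Nat.testBit_shiftRight, Nat.testBit_shiftRight, testBit_addSlice_aux, testBit_addSlice_aux,
    hbit _ (Nat.le_add_right s p)]
  congr 1
  by_cases hb : stride d * (2 - i) ≤ s + p
  · by_cases hB : (lastSlice d).testBit (s + p - stride d * (2 - i)) = true
    · -- the letter is local, so the bit that is added also lies at place `s` or above
      rw [hbit]
      have ht : s + p - stride d * (2 - i) < 27 := by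
        by_contra ht
        rw [Nat.testBit_lt_two_pow ((lastSlice_lt d).trans_le
          (Nat.pow_le_pow_right two_pos (not_lt.mp ht)))] at hB
        exact absurd hB (by decide)
      have := allBelow_spec h ht
      rw [hB] at this
      simp only [Bool.not_true, Bool.false_or, Bool.or_eq_true, Nat.blt_eq, Nat.ble_eq] at this
      change _ + stride d * (2 - i) < s ∨ s ≤ _ + stride d * (2 - j) at this
      omega
    · rw [Bool.not_eq_true] at hB
      simp [hB]
  · simp [hb]

theorem act_shiftRight {s f w : ℕ} (h : isLocal s f w = true) {m n : ℕ}
    (hmn : m >>> s = n >>> s) : act f w m >>> s = act f w n >>> s := by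
  induction f generalizing w m n with
  | zero => exact hmn
  | succ f ih =>
    rw [isLocal] at h
    change (cond _ _ _) >>> s = (cond _ _ _) >>> s
    cases hw : Nat.beq w 0
    · rw [hw, cond_false, Bool.and_eq_true] at h
      exact ih h.2 (addSlice_shiftRight h.1 hmn)
    · exact hmn

/-- A word that lowers the leading bits, computed with zeros in place of the other bits, lowers every
tensor with these leading bits. -/
theorem lt_of_lowers {s : ℕ} {ws : List ℕ} {n : ℕ}
    (hws : ∀ w ∈ ws, w % 8 = 0 ∧ isLocal s 24 (Nat.shiftRight w 3) = true)
    (h : lowers s ws (Nat.shiftLeft (Nat.shiftRight n s) s) = true) : ∃ w, fullAct w n < n := by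
  rw [lowers, List.any_eq_true] at h
  obtain ⟨w, hw, h⟩ := h
  refine ⟨w, ?_⟩
  obtain ⟨h8, hloc⟩ := hws w hw
  have h7 : Nat.land w 7 = 0 := by
    rw [← h8]
    exact Nat.and_two_pow_sub_one_eq_mod w 3
  have hp : ∀ x, permAct 0 x = x := fun x => by simp [permAct]
  have hs : ((n >>> s) <<< s) >>> s = n >>> s := Nat.shiftLeft_shiftRight _ _
  rw [fullAct, h7, hp, Nat.blt_eq] at h
  change act 24 _ ((n >>> s) <<< s) >>> s < ((n >>> s) <<< s) >>> s at h
  rw [hs, act_shiftRight hloc hs] at h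
  rw [fullAct, h7, hp]
  by_contra hle
  refine absurd h (not_lt.mpr ?_)
  rw [Nat.shiftRight_eq_div_pow, Nat.shiftRight_eq_div_pow]
  exact Nat.div_le_div_right (not_lt.mp hle)

theorem lt_of_lowers_zero {ws : List ℕ} {n : ℕ} (h : lowers 0 ws n = true) :
    ∃ w, fullAct w n < n := by
  rw [lowers, List.any_eq_true] at h
  obtain ⟨w, -, h⟩ := h
  exact ⟨w, Nat.blt_eq.mp h⟩

/-- The first slices that no row and column operations lower, one for each rank of a matrix. -/
def minimalHeads : List ℕ := [0, 1, 10, 84]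

/-- The table with a row for the zero tensor in front. -/
def allRows : List Row := ⟨0, 1, 0⟩ :: table

def checkHeads : Bool :=
  allBelow 512 fun p =>
    or (lowers 18 headWords (Nat.shiftLeft p 18)) (minimalHeads.any (Nat.beq p))

def checkPairs : Bool :=
  minimalHeads.all fun h => allBelow 512 fun q =>
    or (lowers 9 (headWords ++ pairWords) (Nat.shiftLeft (Nat.add (Nat.mul h 512) q) 9))
      (minimalPairs.any (Nat.beq (Nat.add (Nat.mul h 512) q)))

def checkTensors : Bool :=
  minimalPairs.all fun p => allBelow 512 fun q =>
    or (lowers 0 (tensorWords ++ (headWords ++ pairWords)) (Nat.add (Nat.mul p 512) q))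
      (allRows.any fun row => Nat.beq (Nat.add (Nat.mul p 512) q) row.code)

/-- The words of all three lists, those that lower the leading slices first. -/
def descentWords : List ℕ := headWords ++ (pairWords ++ tensorWords)

theorem isLocal_headWords : ∀ w ∈ headWords,
    w % 8 = 0 ∧ isLocal 18 24 (Nat.shiftRight w 3) = true := by decide +kernel

theorem isLocal_pairWords : ∀ w ∈ headWords ++ pairWords,
    w % 8 = 0 ∧ isLocal 9 24 (Nat.shiftRight w 3) = true := by decide +kernel

theorem checkHeads_eq_true : checkHeads = true := by decide +kernel

theorem checkPairs_eq_true : checkPairs = true := by decide +kernel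

theorem checkTensors_eq_true : checkTensors = true := by decide +kernel

/-- Only zero and the encodings in the table are lowered by no word. -/
theorem exists_row_code_eq {n : ℕ} (hn : n < 2 ^ 27) (hmin : ∀ w, n ≤ fullAct w n) :
    ∃ row ∈ allRows, row.code = n := by
  have hmin' : ¬ ∃ w, fullAct w n < n := fun ⟨w, hw⟩ => absurd hw (not_lt.mpr (hmin w))
  have h18 : n >>> 18 < 512 := by
    rw [Nat.shiftRight_eq_div_pow]
    omega
  have hhead : n >>> 18 ∈ minimalHeads := by
    rcases (Bool.or_eq_true _ _).mp (allBelow_spec checkHeads_eq_true h18) with h | h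
    · exact absurd (lt_of_lowers isLocal_headWords h) hmin'
    · obtain ⟨x, hx, h⟩ := List.any_eq_true.mp h
      rwa [Nat.beq_eq.mp h]
  have hpair : n >>> 9 ∈ minimalPairs := by
    have hq : n >>> 9 % 512 < 512 := Nat.mod_lt _ (by decide)
    have he : Nat.add (Nat.mul (n >>> 18) 512) (n >>> 9 % 512) = Nat.shiftRight n 9 := by
      change n >>> 18 * 512 + n >>> 9 % 512 = n >>> 9
      simp only [Nat.shiftRight_eq_div_pow]
      omega
    have := allBelow_spec (List.all_eq_true.mp checkPairs_eq_true _ hhead) hq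
    rw [he, Bool.or_eq_true] at this
    rcases this with h | h
    · exact absurd (lt_of_lowers isLocal_pairWords h) hmin'
    · obtain ⟨x, hx, h⟩ := List.any_eq_true.mp h
      rw [Nat.beq_eq] at h
      change n >>> 9 = x at h
      rwa [h]
  have hq : n % 512 < 512 := Nat.mod_lt _ (by decide)
  have he : Nat.add (Nat.mul (n >>> 9) 512) (n % 512) = n := by
    change n >>> 9 * 512 + n % 512 = n
    simp only [Nat.shiftRight_eq_div_pow]
    omega
  have := allBelow_spec (List.all_eq_true.mp checkTensors_eq_true (n >>> 9) hpair) hq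
  rw [he, Bool.or_eq_true] at this
  rcases this with h | h
  · exact absurd (lt_of_lowers_zero h) hmin'
  · obtain ⟨row, hrow, h⟩ := List.any_eq_true.mp h
    exact ⟨row, hrow, (Nat.beq_eq.mp h).symm⟩

theorem exists_row_isMin_orbit (X : Tensor) :
    ∃ row ∈ allRows, decode row.code ∈ MulAction.orbit FullGroup X ∧
      ∀ Y ∈ MulAction.orbit FullGroup X, row.code ≤ encode Y := by
  obtain ⟨Y, hY, hmin⟩ := Set.exists_min_image (MulAction.orbit FullGroup X) encode
    (Set.toFinite _) ⟨X, MulAction.mem_orbit_self X⟩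
  obtain ⟨row, hrow, hcode⟩ := exists_row_code_eq (encode_lt Y) fun w => by
    obtain ⟨g, hg⟩ := exists_fullAct w
    have := hmin (g • Y) (MulAction.mem_orbit_of_mem_orbit g hY)
    rwa [← decode_encode Y, ← hg, decode_encode Y, encode_decode (fullAct_lt w (encode_lt Y))]
      at this
  refine ⟨row, hrow, ?_, fun Z hZ => hcode.trans_le (hmin Z hZ)⟩
  rwa [hcode, decode_encode]

/-! ### Stabilizers and the splitting of large orbits -/

/-- Whether the words of each level fix the numbers in `fixed` and all earlier base points, and take
the base point to distinct points. -/
def isStabilizerChain (fixed : List ℕ) : List (ℕ × List ℕ) → Bool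
  | [] => true
  | l :: ls => and (l.2.all fun w => fixed.all fun x => Nat.beq (act 24 w x) x)
      (and (decide ((l.1 :: l.2.map fun w => act 24 w l.1).Pairwise (· < ·)))
        (and (Nat.blt l.1 (2 ^ 27)) (isStabilizerChain (l.1 :: fixed) ls)))

/-- The product of the numbers of points that the levels of a chain exhibit. -/
def chainOrder (ls : List (ℕ × List ℕ)) : ℕ := (ls.map fun l => l.2.length + 1).prod

/-- The elements of `GL₃(𝔽₂)³` that fix all tensors with encodings in `l`. -/
def fixers (l : List ℕ) : Set GL3Cubed := {g | ∀ x ∈ l, g • decode x = decode x}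

/-- The group that fixes `fixed` has at least as many elements as the chain exhibits: the elements of
one level are representatives of distinct cosets of the stabilizer of the base point. -/
theorem chainOrder_le {ls : List (ℕ × List ℕ)} {fixed : List ℕ}
    (h : isStabilizerChain fixed ls = true) : chainOrder ls ≤ Nat.card (fixers fixed) := by
  induction ls generalizing fixed with
  | nil =>
    have : Nonempty (fixers fixed) := ⟨⟨1, fun x _ => one_smul _ _⟩⟩
    exact Nat.card_pos
  | cons l ls ih =>
    rw [isStabilizerChain, Bool.and_eq_true, Bool.and_eq_true, Bool.and_eq_true] at h
    obtain ⟨hfix, hlt, hb, hls⟩ := h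
    choose G hG using exists_act 24
    have hb : l.1 < 2 ^ 27 := Nat.blt_eq.mp hb
    have hpair := of_decide_eq_true hlt
    -- the coset representatives, one for each point of the orbit of the base point
    let u : Fin (l.2.length + 1) → GL3Cubed := Fin.cons 1 fun k => G (l.2.get k)
    let c : Fin (l.2.length + 1) → ℕ := Fin.cons l.1 fun k => act 24 (l.2.get k) l.1
    have hu : ∀ k, u k ∈ fixers fixed := by
      intro k
      induction k using Fin.cases with
      | zero => exact fun x _ => one_smul _ _
      | succ k =>
        intro x hx
        change G (l.2.get k) • decode x = decode x
        have := List.all_eq_true.mp (List.all_eq_true.mp hfix _ (List.get_mem l.2 k)) x hx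
        rw [← hG, Nat.beq_eq.mp this]
    have huc : ∀ k, u k • decode l.1 = decode (c k) := by
      intro k
      induction k using Fin.cases with
      | zero => exact one_smul _ _
      | succ k => exact (hG _ _).symm
    have hc : ∀ k, c k < 2 ^ 27 := by
      intro k
      induction k using Fin.cases with
      | zero => exact hb
      | succ k => exact act_lt _ _ hb
    have hcinj : Function.Injective c := by
      rw [List.pairwise_cons, List.pairwise_map] at hpair
      refine Fin.cons_injective_iff.mpr ⟨?_, ?_⟩
      · rintro ⟨k, hk⟩
        exact (hpair.1 _ (List.mem_map_of_mem (List.get_mem l.2 k))).ne' hk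
      · have : StrictMono fun k => act 24 (l.2.get k) l.1 := fun k m hkm =>
          List.pairwise_iff_get.mp hpair.2 k m hkm
        exact this.injective
    -- a representative times an element of the stabilizer determines both factors
    let Φ : Fin (l.2.length + 1) × fixers (l.1 :: fixed) → fixers fixed := fun p =>
      ⟨u p.1 * p.2.1, fun x hx => by
        rw [mul_smul, p.2.2 x (List.mem_cons_of_mem _ hx), hu p.1 x hx]⟩
    have hΦ : Function.Injective Φ := by
      rintro ⟨k, a, ha⟩ ⟨m, b, hb'⟩ hab
      have hab : u k * a = u m * b := congrArg Subtype.val hab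
      have h1 := congrArg (· • decode l.1) hab
      simp only [mul_smul, ha l.1 List.mem_cons_self, hb' l.1 List.mem_cons_self, huc] at h1
      have hkm : k = m := hcinj (decode_injOn (hc k) (hc m) h1)
      subst hkm
      have : a = b := mul_left_cancel hab
      subst this
      rfl
    have := Nat.card_le_card_of_injective Φ hΦ
    rw [Nat.card_prod, Nat.card_fin] at this
    calc chainOrder (l :: ls) = (l.2.length + 1) * chainOrder ls := by simp [chainOrder]
      _ ≤ _ := (Nat.mul_le_mul_left _ (ih hls)).trans this

theorem card_GL3Cubed : Nat.card GL3Cubed = 168 ^ 3 := by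
  have : Nat.card (Matrix.GeneralLinearGroup (Fin 3) (ZMod 2)) = 168 := by
    have := Matrix.card_GL_field (𝔽 := ZMod 2) 3
    rw [ZMod.card] at this
    refine this.trans ?_
    simp [Fin.prod_univ_three]
  rw [Nat.card_pi, Fin.prod_univ_three, this]
  rfl

theorem ncard_orbit_mul_card_fixers (n : ℕ) :
    (MulAction.orbit GL3Cubed (decode n)).ncard * Nat.card (fixers [n]) = 168 ^ 3 := by
  have h : Nat.card (fixers [n]) = Nat.card (MulAction.stabilizer GL3Cubed (decode n)) :=
    Nat.card_congr (Equiv.subtypeEquivRight fun g => by simp [fixers])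
  rw [h, ← MulAction.index_stabilizer, mul_comm, Subgroup.card_mul_index, card_GL3Cubed]

/-- A cyclic permutation of the three directions. -/
def rotate (x : ℕ) : ℕ := permAct 3 x

/-- Encodings of representatives of the small orbits within a large one: the canonical form alone if
all permutations of the directions extend to symmetries, and its three rotations if only one
transposition does. -/
def smallCodes (row : Row) (c : Certificate) : List ℕ :=
  if c.symmetries.length = 2 then [row.code]
  else [row.code, rotate row.code, rotate (rotate row.code)]

/-- Whether the words fix the canonical form and involve the permutations that `smallCodes` relies
on: the numbers 1, 2 and 7 stand for the three transpositions. -/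
def checkSymmetries (row : Row) (c : Certificate) : Bool :=
  and (c.symmetries.all fun w => Nat.beq (fullAct w row.code) row.code)
    ([[1, 2], [1], [2], [7]].contains (c.symmetries.map fun w => Nat.land w 7))

theorem permute_mem_orbit {δ : Equiv.Perm (Fin 3)} {X Y : Tensor}
    (h : Y ∈ MulAction.orbit GL3Cubed X) :
    permute δ Y ∈ MulAction.orbit GL3Cubed (permute δ X) := by
  obtain ⟨A, rfl⟩ := h
  exact ⟨(mulAutArrow δ : MulAut GL3Cubed) A, (permute_changeBasis δ A X).symm⟩

/-- A symmetry identifies the small orbits of a tensor and of its image under a permutation. -/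
theorem permute_permOf_mem_orbit {w n : ℕ} (h : fullAct w n = n) :
    permute (permOf (Nat.land w 7)) (decode n) ∈ MulAction.orbit GL3Cubed (decode n) := by
  obtain ⟨g, hg⟩ := exists_act 24 (Nat.shiftRight w 3)
  rw [MulAction.mem_orbit_symm]
  refine ⟨g, ?_⟩
  change g • permute _ _ = _
  rw [← decode_permAct, ← hg]
  exact congrArg decode h

/-- The small orbits of `smallCodes` cover the large orbit.  Every permutation is a product of the two
transpositions that extend to symmetries in the first case, and a rotation after a power of the
transposition that extends to one in the second. -/
theorem exists_smallCode {row : Row} {c : Certificate} (h : checkSymmetries row c = true)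
    {X : Tensor} (hX : X ∈ MulAction.orbit FullGroup (decode row.code)) :
    ∃ n ∈ smallCodes row c, X ∈ MulAction.orbit GL3Cubed (decode n) := by
  obtain ⟨g, rfl⟩ := hX
  have hg : ∀ n, permute g.right (decode row.code) ∈ MulAction.orbit GL3Cubed (decode n) →
      g • decode row.code ∈ MulAction.orbit GL3Cubed (decode n) := fun n hn =>
    MulAction.mem_orbit_of_mem_orbit g.left hn
  suffices ∃ n ∈ smallCodes row c,
      permute g.right (decode row.code) ∈ MulAction.orbit GL3Cubed (decode n) by
    obtain ⟨n, hn, h⟩ := this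
    exact ⟨n, hn, hg n h⟩
  generalize g.right = δ
  rw [checkSymmetries, Bool.and_eq_true] at h
  obtain ⟨hfix, hmem⟩ := h
  have hs : ∀ p ∈ c.symmetries.map fun w => Nat.land w 7,
      permute (permOf p) (decode row.code) ∈ MulAction.orbit GL3Cubed (decode row.code) := by
    intro p hp
    obtain ⟨w, hw, rfl⟩ := List.mem_map.mp hp
    exact permute_permOf_mem_orbit (Nat.beq_eq.mp (List.all_eq_true.mp hfix w hw))
  have hlen : c.symmetries.length = (c.symmetries.map fun w => Nat.land w 7).length := by simp
  rw [smallCodes, hlen]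
  generalize (c.symmetries.map fun w => Nat.land w 7) = ps at *
  have hrot : ∀ n, decode (rotate n) = permute (permOf 3) (decode n) := decode_permAct 3
  by_cases h2 : ps = [1, 2]
  · subst h2
    refine ⟨row.code, by simp, ?_⟩
    have e1 := hs 1 (by simp)
    have e2 := hs 2 (by simp)
    have hmul : ∀ {α β : Equiv.Perm (Fin 3)},
        permute α (decode row.code) ∈ MulAction.orbit GL3Cubed (decode row.code) →
        permute β (decode row.code) ∈ MulAction.orbit GL3Cubed (decode row.code) →
        permute (α * β) (decode row.code) ∈ MulAction.orbit GL3Cubed (decode row.code) := by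
      intro α β hα hβ
      rw [permute_mul]
      exact MulAction.orbit_eq_iff.mpr hα ▸ permute_mem_orbit hβ
    have : ∀ δ : Equiv.Perm (Fin 3), δ = permOf 1 * permOf 1 ∨ δ = permOf 1 ∨ δ = permOf 2 ∨
        δ = permOf 1 * permOf 2 ∨ δ = permOf 2 * permOf 1 ∨
        δ = permOf 1 * (permOf 2 * permOf 1) := by decide +kernel
    rcases this δ with rfl | rfl | rfl | rfl | rfl | rfl
    exacts [hmul e1 e1, e1, e2, hmul e1 e2, hmul e2 e1, hmul e1 (hmul e2 e1)]
  · have h3 : ∃ p, (p = 1 ∨ p = 2 ∨ p = 7) ∧ ps = [p] := by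
      simp only [List.contains_iff_mem, List.mem_cons, List.not_mem_nil, or_false] at hmem
      rcases hmem with h | h | h | h
      exacts [absurd h h2, ⟨1, by simp, h⟩, ⟨2, by simp, h⟩, ⟨7, by simp, h⟩]
    obtain ⟨p, hp, rfl⟩ := h3
    have e := hs p (by simp)
    have : ∀ p : Fin 8, p = 1 ∨ p = 2 ∨ p = 7 → ∀ δ : Equiv.Perm (Fin 3),
        ∃ ε, (ε = 1 ∨ ε = permOf p) ∧
          (δ = ε ∨ δ = permOf 3 * ε ∨ δ = permOf 3 * (permOf 3 * ε)) := by decide +kernel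
    have : ∃ ε, (ε = 1 ∨ ε = permOf p) ∧
        (δ = ε ∨ δ = permOf 3 * ε ∨ δ = permOf 3 * (permOf 3 * ε)) := by
      rcases hp with rfl | rfl | rfl
      exacts [this 1 (by simp) δ, this 2 (by simp) δ, this 7 (by simp) δ]
    obtain ⟨ε, hε, hδ⟩ := this
    have e' : permute ε (decode row.code) ∈ MulAction.orbit GL3Cubed (decode row.code) := by
      rcases hε with rfl | rfl
      exacts [MulAction.mem_orbit_self _, e]
    simp only [List.length_singleton, OfNat.one_ne_ofNat, if_false, List.mem_cons,
      List.not_mem_nil, or_false, exists_eq_or_imp, exists_eq_left, hrot]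
    rcases hδ with rfl | rfl | rfl
    · exact Or.inl e'
    · exact Or.inr (Or.inl (permute_mem_orbit e'))
    · exact Or.inr (Or.inr (permute_mem_orbit (permute_mem_orbit e')))

theorem ncard_orbit_permute_le (δ : Equiv.Perm (Fin 3)) (X : Tensor) :
    (MulAction.orbit GL3Cubed (permute δ X)).ncard ≤ (MulAction.orbit GL3Cubed X).ncard := by
  have : MulAction.orbit GL3Cubed (permute δ X) ⊆ permute δ '' MulAction.orbit GL3Cubed X := by
    rintro _ ⟨A, rfl⟩
    refine ⟨(mulAutArrow δ : MulAut GL3Cubed).symm A • X, ⟨_, rfl⟩, ?_⟩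
    change permute δ (changeBasis _ X) = changeBasis A _
    rw [permute_changeBasis, MulEquiv.apply_symm_apply]
  exact (Set.ncard_le_ncard this (Set.toFinite _)).trans (Set.ncard_image_le (Set.toFinite _))

/-- Whether the certificate accounts for the size of the orbit: the stabilizer of the canonical form
in `GL₃(𝔽₂)³` has the order that the size requires. -/
def checkSize (row : Row) (c : Certificate) : Bool :=
  and (isStabilizerChain [row.code] c.chain) (and (checkSymmetries row c)
    (and (Nat.beq (row.size / (smallCodes row c).length * chainOrder c.chain) (168 ^ 3))
      (Nat.beq (row.size / (smallCodes row c).length * (smallCodes row c).length) row.size)))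

theorem ncard_orbit_smallCode_le {row : Row} {c : Certificate} (h : checkSize row c = true)
    {n : ℕ} (hn : n ∈ smallCodes row c) :
    (MulAction.orbit GL3Cubed (decode n)).ncard ≤ row.size / (smallCodes row c).length := by
  simp only [checkSize, Bool.and_eq_true, Nat.beq_eq] at h
  obtain ⟨hchain, -, hsize, -⟩ := h
  have hpos : 0 < chainOrder c.chain := by
    by_contra h0
    rw [not_lt, Nat.le_zero] at h0
    rw [h0] at hsize
    exact absurd hsize (by simp)
  have hrow : (MulAction.orbit GL3Cubed (decode row.code)).ncard ≤
      row.size / (smallCodes row c).length := by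
    refine Nat.le_of_mul_le_mul_right ?_ hpos
    rw [hsize]
    exact (Nat.mul_le_mul_left _ (chainOrder_le hchain)).trans
      (ncard_orbit_mul_card_fixers row.code).le
  have hrot : ∀ n, (MulAction.orbit GL3Cubed (decode (rotate n))).ncard ≤
      (MulAction.orbit GL3Cubed (decode n)).ncard := fun n => by
    rw [rotate, decode_permAct]
    exact ncard_orbit_permute_le _ _
  refine le_trans ?_ hrow
  unfold smallCodes at hn
  split at hn
  · rw [List.mem_singleton.mp hn]
  · simp only [List.mem_cons, List.not_mem_nil, or_false] at hn
    rcases hn with rfl | rfl | rfl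
    exacts [le_rfl, hrot _, (hrot _).trans (hrot _)]

/-! ### Counting: the listed orbits are disjoint and exhaust the tensors -/

section Counting

variable {Γ : Type} [Group Γ] [MulAction Γ Tensor] {t : List Row}

/-- The orbits represented by the rows of `t` cover all tensors, and the sizes in `t` are upper bounds
for the sizes of the orbits that add up to the number of all tensors. -/
structure Covers (Γ : Type) [Group Γ] [MulAction Γ Tensor] (t : List Row) : Prop where
  exists_mem : ∀ X : Tensor, ∃ k : Fin t.length, X ∈ MulAction.orbit Γ (decode (t.get k).code)
  ncard_le : ∀ k : Fin t.length,
    (MulAction.orbit Γ (decode (t.get k).code)).ncard ≤ (t.get k).size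
  sum_size : ∑ k : Fin t.length, (t.get k).size = 2 ^ 27

theorem card_tensor : Nat.card Tensor = 2 ^ 27 := by
  rw [Nat.card_fun]
  simp

theorem le_sum_ncard_orbit (s : Finset (Fin t.length))
    (hs : ∀ X : Tensor, ∃ k ∈ s, X ∈ MulAction.orbit Γ (decode (t.get k).code)) :
    2 ^ 27 ≤ ∑ k ∈ s, (MulAction.orbit Γ (decode (t.get k).code)).ncard := by
  classical
  have : (Finset.univ : Finset Tensor) ⊆
      s.biUnion fun k => (MulAction.orbit Γ (decode (t.get k).code)).toFinite.toFinset := by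
    intro X _
    obtain ⟨k, hk, hX⟩ := hs X
    exact Finset.mem_biUnion.mpr ⟨k, hk, (Set.Finite.mem_toFinset _).mpr hX⟩
  calc 2 ^ 27 = (Finset.univ : Finset Tensor).card := by
        rw [Finset.card_univ, ← Nat.card_eq_fintype_card, card_tensor]
    _ ≤ _ := Finset.card_le_card this
    _ ≤ _ := Finset.card_biUnion_le
    _ = _ := Finset.sum_congr rfl fun k _ => (Set.ncard_eq_toFinset_card _ _).symm

theorem Covers.ncard_eq (h : Covers Γ t) (k : Fin t.length) :
    (MulAction.orbit Γ (decode (t.get k).code)).ncard = (t.get k).size := by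
  refine le_antisymm (h.ncard_le k) (not_lt.mp fun hlt => ?_)
  have h1 := le_sum_ncard_orbit Finset.univ fun X => by simpa using h.exists_mem X
  have h2 := Finset.sum_lt_sum (fun k (_ : k ∈ Finset.univ) => h.ncard_le k)
    ⟨k, Finset.mem_univ k, hlt⟩
  rw [h.sum_size] at h2
  exact absurd h1 (not_le.mpr h2)

theorem Covers.index_unique (h : Covers Γ t) {X : Tensor} {k m : Fin t.length}
    (hk : X ∈ MulAction.orbit Γ (decode (t.get k).code))
    (hm : X ∈ MulAction.orbit Γ (decode (t.get m).code)) : k = m := by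
  by_contra hne
  have horb : MulAction.orbit Γ (decode (t.get k).code) =
      MulAction.orbit Γ (decode (t.get m).code) :=
    (MulAction.orbit_eq_iff.mpr hk).symm.trans (MulAction.orbit_eq_iff.mpr hm)
  -- if two listed orbits coincide, the list covers everything without one of them
  have h1 := le_sum_ncard_orbit (Finset.univ.erase m) fun Y => by
    obtain ⟨l, hl⟩ := h.exists_mem Y
    by_cases hlm : l = m
    · exact ⟨k, by simp [hne], by rw [horb, ← hlm]; exact hl⟩
    · exact ⟨l, by simp [hlm], hl⟩
  have h2 := Finset.add_sum_erase Finset.univ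
    (fun k => (MulAction.orbit Γ (decode (t.get k).code)).ncard) (Finset.mem_univ m)
  simp only [h.ncard_eq] at h1 h2
  rw [h.sum_size] at h2
  have h3 : 0 < (t.get m).size := by
    rw [← h.ncard_eq m]
    exact (Set.ncard_pos (Set.toFinite _)).mpr ⟨_, MulAction.mem_orbit_self _⟩
  omega

theorem Covers.orbit_injective (h : Covers Γ t) :
    Function.Injective fun k : Fin t.length => MulAction.orbit Γ (decode (t.get k).code) :=
  fun _ _ hkm => h.index_unique (MulAction.mem_orbit_self _)
    ((Set.ext_iff.mp hkm _).mp (MulAction.mem_orbit_self _))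

theorem Covers.ncard_orbits (h : Covers Γ t) (P : Tensor → Prop) (p : Fin t.length → Bool)
    (hp : ∀ k, ∀ X ∈ MulAction.orbit Γ (decode (t.get k).code), P X ↔ p k = true) :
    {O : Set Tensor | ∃ X, P X ∧ O = MulAction.orbit Γ X}.ncard =
      (Finset.univ.filter fun k => p k = true).card := by
  have : {O : Set Tensor | ∃ X, P X ∧ O = MulAction.orbit Γ X} =
      (fun k : Fin t.length => MulAction.orbit Γ (decode (t.get k).code)) ''
        (Finset.univ.filter fun k => p k = true : Finset (Fin t.length)) := by
    ext O
    simp only [Set.mem_ofPred_eq, Set.mem_image, Finset.coe_filter, Finset.mem_univ, true_and]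
    constructor
    · rintro ⟨X, hX, rfl⟩
      obtain ⟨k, hk⟩ := h.exists_mem X
      exact ⟨k, (hp k X hk).mp hX, (MulAction.orbit_eq_iff.mpr hk).symm⟩
    · rintro ⟨k, hk, rfl⟩
      exact ⟨_, (hp k _ (MulAction.mem_orbit_self _)).mpr hk, rfl⟩
  rw [this, Set.ncard_image_of_injective _ h.orbit_injective, Set.ncard_coe_finset]

theorem Covers.ncard_setOf (h : Covers Γ t) (P : Tensor → Prop) (p : Fin t.length → Bool)
    (hp : ∀ k, ∀ X ∈ MulAction.orbit Γ (decode (t.get k).code), P X ↔ p k = true) :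
    {X | P X}.ncard = ∑ k with p k = true, (t.get k).size := by
  classical
  have : {X | P X} = ((Finset.univ.filter fun k => p k = true).biUnion fun k =>
      (MulAction.orbit Γ (decode (t.get k).code)).toFinite.toFinset : Finset Tensor) := by
    ext X
    simp only [Set.mem_ofPred_eq, Finset.mem_coe, Finset.mem_biUnion, Finset.mem_filter,
      Finset.mem_univ, true_and, Set.Finite.mem_toFinset]
    constructor
    · intro hX
      obtain ⟨k, hk⟩ := h.exists_mem X
      exact ⟨k, (hp k X hk).mp hX, hk⟩
    · rintro ⟨k, hk, hX⟩
      exact (hp k X hX).mpr hk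
  rw [this, Set.ncard_coe_finset, Finset.card_biUnion]
  · exact Finset.sum_congr rfl fun k _ => by
      rw [← Set.ncard_eq_toFinset_card, h.ncard_eq]
  · intro k _ m _ hkm
    rw [Function.onFun, Finset.disjoint_left]
    intro X hk hm
    exact hkm (h.index_unique ((Set.Finite.mem_toFinset _).mp hk)
      ((Set.Finite.mem_toFinset _).mp hm))

end Counting

/-- The rows of the table with their certificates. -/
def certifiedRows : List (Row × Certificate) := table.zip certificates

theorem exists_certificate {row : Row} (h : row ∈ table) : ∃ c, (row, c) ∈ certifiedRows := by
  have : certifiedRows.map Prod.fst = table := List.map_fst_zip (by decide)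
  rw [← this, List.mem_map] at h
  obtain ⟨⟨r, c⟩, hrc, rfl⟩ := h
  exact ⟨c, hrc⟩

theorem mem_table_of_mem_certifiedRows {rc : Row × Certificate} (h : rc ∈ certifiedRows) :
    rc.1 ∈ table := (List.of_mem_zip h).1

/-- The small orbits, including that of zero, in the format of the table. -/
def smallRows : List Row :=
  ⟨0, 1, 0⟩ :: certifiedRows.flatMap fun rc => (smallCodes rc.1 rc.2).map fun n =>
    ⟨rc.1.rank, rc.1.size / (smallCodes rc.1 rc.2).length, n⟩

def checkSizes : Bool := certifiedRows.all fun rc => checkSize rc.1 rc.2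

theorem checkSizes_eq_true : checkSizes = true := by decide +kernel

theorem checkSize_eq_true {rc : Row × Certificate} (h : rc ∈ certifiedRows) :
    checkSize rc.1 rc.2 = true := List.all_eq_true.mp checkSizes_eq_true rc h

theorem checkSymmetries_eq_true {rc : Row × Certificate} (h : rc ∈ certifiedRows) :
    checkSymmetries rc.1 rc.2 = true := by
  have := checkSize_eq_true h
  simp only [checkSize, Bool.and_eq_true] at this
  exact this.2.1

theorem mem_smallRows {row : Row} : row ∈ smallRows ↔ row = ⟨0, 1, 0⟩ ∨
    ∃ rc ∈ certifiedRows, ∃ n ∈ smallCodes rc.1 rc.2,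
      row = ⟨rc.1.rank, rc.1.size / (smallCodes rc.1 rc.2).length, n⟩ := by
  simp only [smallRows, List.mem_cons, List.mem_flatMap, List.mem_map, eq_comm (a := row)]

theorem orbit_decode_zero (Γ : Type) [Group Γ] [MulAction Γ Tensor]
    (h : ∀ g : Γ, g • (0 : Tensor) = 0) : MulAction.orbit Γ (decode 0) = {0} := by
  rw [decode_zero]
  ext X
  constructor
  · rintro ⟨g, rfl⟩
    exact h g
  · rintro rfl
    exact MulAction.mem_orbit_self _

theorem mem_full_orbit_of_mem_orbit {X Y : Tensor} (h : X ∈ MulAction.orbit GL3Cubed Y) :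
    X ∈ MulAction.orbit FullGroup Y := by
  obtain ⟨A, rfl⟩ := h
  exact ⟨⟨A, 1⟩, rfl⟩

theorem decode_smallCode_mem_orbit {row : Row} {c : Certificate} {n : ℕ}
    (hn : n ∈ smallCodes row c) : decode n ∈ MulAction.orbit FullGroup (decode row.code) := by
  have hrot : ∀ m, decode (rotate m) ∈ MulAction.orbit FullGroup (decode m) := by
    intro m
    rw [rotate, decode_permAct]
    exact ⟨⟨1, permOf 3⟩, (full_smul_def _ _).trans (one_smul GL3Cubed _)⟩
  unfold smallCodes at hn
  split at hn
  · rw [List.mem_singleton.mp hn]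
    exact MulAction.mem_orbit_self _
  · simp only [List.mem_cons, List.not_mem_nil, or_false] at hn
    rcases hn with rfl | rfl | rfl
    exacts [MulAction.mem_orbit_self _, hrot _,
      MulAction.orbit_eq_iff.mpr (hrot row.code) ▸ hrot (rotate row.code)]

theorem exists_get_of_mem {α : Type*} {l : List α} {p : α → Prop} (h : ∃ a ∈ l, p a) :
    ∃ k : Fin l.length, p (l.get k) := by
  obtain ⟨a, ha, hp⟩ := h
  obtain ⟨k, rfl⟩ := List.get_of_mem ha
  exact ⟨k, hp⟩

theorem covers_allRows : Covers FullGroup allRows where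
  exists_mem X := exists_get_of_mem
    (p := fun row : Row => X ∈ MulAction.orbit FullGroup (decode row.code)) (by
    obtain ⟨row, hrow, h, -⟩ := exists_row_isMin_orbit X
    exact ⟨row, hrow, MulAction.mem_orbit_symm.mp h⟩)
  ncard_le k := by
    rcases List.mem_cons.mp (List.get_mem allRows k) with h | h
    · rw [h, orbit_decode_zero _ full_smul_zero, Set.ncard_singleton]
    · obtain ⟨c, hc⟩ := exists_certificate h
      generalize allRows.get k = row at *
      have hsub : MulAction.orbit FullGroup (decode row.code) ⊆
          ⋃ n ∈ (smallCodes row c).toFinset, MulAction.orbit GL3Cubed (decode n) := by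
        intro X hX
        obtain ⟨n, hn, hXn⟩ := exists_smallCode (checkSymmetries_eq_true hc) hX
        exact Set.mem_biUnion (List.mem_toFinset.mpr hn) hXn
      have hsize := checkSize_eq_true hc
      simp only [checkSize, Bool.and_eq_true, Nat.beq_eq] at hsize
      calc _ ≤ _ := Set.ncard_le_ncard hsub (Set.toFinite _)
        _ ≤ _ := Finset.set_ncard_biUnion_le _ _
        _ ≤ ∑ n ∈ (smallCodes row c).toFinset, row.size / (smallCodes row c).length :=
          Finset.sum_le_sum fun n hn =>
            ncard_orbit_smallCode_le (checkSize_eq_true hc) (List.mem_toFinset.mp hn)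
        _ = (smallCodes row c).toFinset.card * (row.size / (smallCodes row c).length) := by
          rw [Finset.sum_const, smul_eq_mul]
        _ ≤ (smallCodes row c).length * (row.size / (smallCodes row c).length) :=
          Nat.mul_le_mul_right _ (List.toFinset_card_le _)
        _ = row.size := by rw [mul_comm, hsize.2.2.2]
  sum_size := by decide +kernel

theorem covers_smallRows : Covers GL3Cubed smallRows where
  exists_mem X := exists_get_of_mem
    (p := fun row : Row => X ∈ MulAction.orbit GL3Cubed (decode row.code)) (by
    obtain ⟨k, hk⟩ := covers_allRows.exists_mem X
    rcases List.mem_cons.mp (List.get_mem allRows k) with h | h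
    · rw [h, orbit_decode_zero _ full_smul_zero] at hk
      refine ⟨⟨0, 1, 0⟩, mem_smallRows.mpr (Or.inl rfl), ?_⟩
      rwa [← orbit_decode_zero GL3Cubed smul_zero_tensor] at hk
    · obtain ⟨c, hc⟩ := exists_certificate h
      obtain ⟨n, hn, hX⟩ := exists_smallCode (checkSymmetries_eq_true hc) hk
      exact ⟨_, mem_smallRows.mpr (Or.inr ⟨_, hc, n, hn, rfl⟩), hX⟩)
  ncard_le k := by
    rcases mem_smallRows.mp (List.get_mem smallRows k) with h | ⟨rc, hrc, n, hn, h⟩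
    · rw [h, orbit_decode_zero _ smul_zero_tensor, Set.ncard_singleton]
    · rw [h]
      exact ncard_orbit_smallCode_le (checkSize_eq_true hrc) hn
  sum_size := by decide +kernel

/-! ### Ranks -/

/-- The result of the first word in the list that lowers `n`, or `n` if there is none. -/
def firstLower : List ℕ → ℕ → ℕ
  | [], n => n
  | w :: ws, n => cond (Nat.blt (fullAct w n) n) (fullAct w n) (firstLower ws n)

/-- Lower `n` by `descentWords` until no word lowers it, in a bounded number of steps. -/
def descend : ℕ → ℕ → ℕ
  | 0, n => n
  | f + 1, n =>
    cond (Nat.beq (firstLower descentWords n) n) n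
      (descend f (firstLower descentWords n))

/-- Whether `n` descends to the encoding of a row with property `p`. -/
def descendsTo (p : Row → Bool) (n : ℕ) : Bool :=
  allRows.any fun row => and (p row) (Nat.beq row.code (descend 100 n))

/-- Whether one of the group elements in the certificate, all of which fix the canonical form of the
row, lowers `s`. -/
def shrinks (c : Certificate) (s : ℕ) : Bool :=
  or (c.symmetries.any fun w => Nat.blt (fullAct w s) s)
    (c.chain.any fun l => l.2.any fun w => Nat.blt (act 24 w s) s)

/-- The condition checked for the label `r'` of the sum of a simple tensor and a tensor of label
`r`. -/
def adjacentRank (r r' : ℕ) : Bool := cond (Nat.beq r 6) (Nat.ble 5 r') (Nat.ble r' (Nat.succ r))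

/-- Whether `adjacentRank` holds for the sums of the canonical form of `row` with those simple tensors
which the group elements in the certificate do not lower. -/
def checkNeighbours (row : Row) (c : Certificate) : Bool :=
  simpleCodes.all fun s => or (shrinks c s)
    (descendsTo (fun row' => adjacentRank row.rank row'.rank) (Nat.xor row.code s))

/-- Every group element fixes zero, so all words serve as symmetries. -/
def zeroCertificate : Certificate := ⟨0, descentWords, []⟩

def checkRanks : Bool :=
  and (zeroCertificate.symmetries.all fun w => Nat.beq (fullAct w 0) 0)
    (and (checkNeighbours ⟨0, 1, 0⟩ zeroCertificate)
      (certifiedRows.all fun rc => or (Nat.beq rc.1.rank 4) (or (Nat.beq rc.1.rank 5)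
        (checkNeighbours rc.1 rc.2))))

def checkPeels : Bool := certifiedRows.all fun rc =>
  and (descendsTo (fun row => Nat.beq row.code 1) rc.2.peel)
    (descendsTo (fun row => Nat.beq (Nat.succ row.rank) rc.1.rank)
      (Nat.xor rc.1.code rc.2.peel))

theorem checkRanks_eq_true : checkRanks = true := by decide +kernel

theorem checkPeels_eq_true : checkPeels = true := by decide +kernel

theorem decode_firstLower_mem (ws : List ℕ) (n : ℕ) :
    decode (firstLower ws n) ∈ MulAction.orbit FullGroup (decode n) := by
  induction ws with
  | nil => exact MulAction.mem_orbit_self _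
  | cons w ws ih =>
    rw [firstLower]
    cases Nat.blt (fullAct w n) n
    · exact ih
    · obtain ⟨g, hg⟩ := exists_fullAct w
      exact ⟨g, (hg n).symm⟩

theorem decode_descend_mem (f n : ℕ) :
    decode (descend f n) ∈ MulAction.orbit FullGroup (decode n) := by
  induction f generalizing n with
  | zero => exact MulAction.mem_orbit_self _
  | succ f ih =>
    rw [descend]
    cases Nat.beq (firstLower descentWords n) n
    · exact MulAction.orbit_eq_iff.mpr (decode_firstLower_mem _ n) ▸ ih _
    · exact MulAction.mem_orbit_self _

theorem exists_row_of_descendsTo {p : Row → Bool} {n : ℕ} (h : descendsTo p n = true) :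
    ∃ row ∈ allRows, p row = true ∧ decode n ∈ MulAction.orbit FullGroup (decode row.code) := by
  obtain ⟨row, hrow, h⟩ := List.any_eq_true.mp h
  rw [Bool.and_eq_true, Nat.beq_eq] at h
  refine ⟨row, hrow, h.1, ?_⟩
  rw [h.2]
  exact MulAction.mem_orbit_symm.mp (decode_descend_mem _ _)

/-- All group elements in the certificate fix the canonical form of the row. -/
def Fixes (c : Certificate) (row : Row) : Prop :=
  (∀ w ∈ c.symmetries, fullAct w row.code = row.code) ∧
    ∀ l ∈ c.chain, ∀ w ∈ l.2, act 24 w row.code = row.code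

theorem isStabilizerChain_fixes {ls : List (ℕ × List ℕ)} {fixed : List ℕ}
    (h : isStabilizerChain fixed ls = true) {x : ℕ} (hx : x ∈ fixed) :
    ∀ l ∈ ls, ∀ w ∈ l.2, act 24 w x = x := by
  induction ls generalizing fixed with
  | nil => simp
  | cons l ls ih =>
    rw [isStabilizerChain, Bool.and_eq_true, Bool.and_eq_true, Bool.and_eq_true] at h
    intro l' hl' w hw
    rcases List.mem_cons.mp hl' with rfl | hl'
    · exact Nat.beq_eq.mp (List.all_eq_true.mp (List.all_eq_true.mp h.1 w hw) x hx)
    · exact ih h.2.2.2 (List.mem_cons_of_mem _ hx) l' hl' w hw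

theorem fixes_of_mem_certifiedRows {rc : Row × Certificate} (h : rc ∈ certifiedRows) :
    Fixes rc.2 rc.1 := by
  have := checkSize_eq_true h
  rw [checkSize, checkSymmetries] at this
  simp only [Bool.and_eq_true] at this
  exact ⟨fun w hw => Nat.beq_eq.mp (List.all_eq_true.mp this.2.1.1 w hw),
    isStabilizerChain_fixes this.1 List.mem_cons_self⟩

theorem exists_smul_of_shrinks {c : Certificate} {row : Row} (hc : Fixes c row) {s : ℕ}
    (hs : s < 2 ^ 27) (h : shrinks c s = true) :
    ∃ g : FullGroup, g • decode row.code = decode row.code ∧ encode (g • decode s) < s := by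
  rw [shrinks, Bool.or_eq_true] at h
  rcases h with h | h
  · obtain ⟨w, hw, h⟩ := List.any_eq_true.mp h
    obtain ⟨g, hg⟩ := exists_fullAct w
    refine ⟨g, by rw [← hg, hc.1 w hw], ?_⟩
    rw [← hg, encode_decode (fullAct_lt _ hs)]
    exact Nat.blt_eq.mp h
  · obtain ⟨l, hl, h⟩ := List.any_eq_true.mp h
    obtain ⟨w, hw, h⟩ := List.any_eq_true.mp h
    obtain ⟨A, hA⟩ := exists_act 24 w
    have hg : ∀ x, decode (act 24 w x) = (⟨A, 1⟩ : FullGroup) • decode x := hA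
    refine ⟨⟨A, 1⟩, by rw [← hg, hc.2 l hl w hw], ?_⟩
    rw [← hg, encode_decode (act_lt _ _ hs)]
    exact Nat.blt_eq.mp h

/-- By induction on the encoding of the simple tensor: a symmetry of the canonical form that lowers
it does not change the large orbit of the sum. -/
theorem exists_row_add_simple {c : Certificate} {row : Row} (hc : Fixes c row)
    (h : checkNeighbours row c = true) {S : Tensor} (hS : IsSimple S) :
    ∃ row' ∈ allRows, adjacentRank row.rank row'.rank = true ∧
      decode row.code + S ∈ MulAction.orbit FullGroup (decode row'.code) := by
  induction hn : encode S using Nat.strong_induction_on generalizing S with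
  | _ n ih =>
    have := List.all_eq_true.mp h _ hS.encode_mem
    rw [Bool.or_eq_true] at this
    rcases this with h' | h'
    · obtain ⟨g, hg, hlt⟩ := exists_smul_of_shrinks hc (encode_lt S) h'
      rw [decode_encode] at hlt
      obtain ⟨row', hrow', had, hmem⟩ := ih _ (hn ▸ hlt) (hS.full_smul g) rfl
      refine ⟨row', hrow', had, ?_⟩
      rw [← hg, ← full_smul_add] at hmem
      simpa only [inv_smul_smul] using MulAction.mem_orbit_of_mem_orbit g⁻¹ hmem
    · obtain ⟨row', hrow', had, hmem⟩ := exists_row_of_descendsTo h'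
      rw [decode_xor, decode_encode] at hmem
      exact ⟨row', hrow', had, hmem⟩

/-- The table assigns the rank `r` to the large orbit of `X`. -/
def HasLabel (X : Tensor) (r : ℕ) : Prop :=
  ∃ row ∈ allRows, row.rank = r ∧ X ∈ MulAction.orbit FullGroup (decode row.code)

theorem HasLabel.unique {X : Tensor} {r r' : ℕ} (h : HasLabel X r) (h' : HasLabel X r') :
    r = r' := by
  obtain ⟨row, hrow, rfl, hX⟩ := h
  obtain ⟨row', hrow', rfl, hX'⟩ := h'
  obtain ⟨k, rfl⟩ := List.get_of_mem hrow
  obtain ⟨k', rfl⟩ := List.get_of_mem hrow'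
  rw [covers_allRows.index_unique hX hX']

theorem exists_hasLabel (X : Tensor) : ∃ r, HasLabel X r := by
  obtain ⟨k, hk⟩ := covers_allRows.exists_mem X
  exact ⟨_, _, List.get_mem allRows k, rfl, hk⟩

theorem HasLabel.le_six {X : Tensor} {r : ℕ} (h : HasLabel X r) : r ≤ 6 := by
  obtain ⟨row, hrow, rfl, -⟩ := h
  have : ∀ row ∈ allRows, row.rank ≤ 6 := by decide
  exact this row hrow

theorem HasLabel.exists_add {X S : Tensor} {r : ℕ} (h : HasLabel X r) (hS : IsSimple S)
    (h4 : r ≠ 4) (h5 : r ≠ 5) : ∃ r', HasLabel (X + S) r' ∧ adjacentRank r r' = true := by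
  obtain ⟨row, hrow, rfl, g, rfl⟩ := h
  have hcheck := checkRanks_eq_true
  rw [checkRanks, Bool.and_eq_true, Bool.and_eq_true] at hcheck
  obtain ⟨hzero, hnzero, hall⟩ := hcheck
  have : ∃ c, Fixes c row ∧ checkNeighbours row c = true := by
    rcases List.mem_cons.mp hrow with rfl | hrow
    · exact ⟨zeroCertificate, ⟨fun w hw => Nat.beq_eq.mp (List.all_eq_true.mp hzero w hw),
        fun l hl => absurd hl List.not_mem_nil⟩, hnzero⟩
    · obtain ⟨c, hc⟩ := exists_certificate hrow
      refine ⟨c, fixes_of_mem_certifiedRows hc, ?_⟩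
      have := List.all_eq_true.mp hall _ hc
      simpa only [Bool.or_eq_true, Nat.beq_eq, h4, h5, false_or] using this
  obtain ⟨c, hfix, hc⟩ := this
  obtain ⟨row', hrow', had, hmem⟩ := exists_row_add_simple hfix hc (hS.full_smul g⁻¹)
  refine ⟨row'.rank, ⟨row', hrow', rfl, ?_⟩, had⟩
  have := MulAction.mem_orbit_of_mem_orbit g hmem
  rwa [full_smul_add, smul_inv_smul] at this

/-- The label grows by at most one when a simple tensor is added. -/
theorem HasLabel.le_succ {X S : Tensor} {r r' : ℕ} (h : HasLabel X r) (hS : IsSimple S)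
    (h' : HasLabel (X + S) r') : r' ≤ r + 1 := by
  have h6 := h'.le_six
  by_cases h5 : 5 ≤ r
  · omega
  by_cases h4 : r = 4
  · by_contra hlt
    obtain rfl : r' = 6 := by omega
    -- adding `S` again leads from label 6 back to label 4, which is too far
    obtain ⟨s, hs, had⟩ := h'.exists_add hS (by decide) (by decide)
    rw [add_add_cancel_self] at hs
    rw [hs.unique h, h4] at had
    exact absurd had (by decide)
  · obtain ⟨s, hs, had⟩ := h.exists_add hS h4 (by omega)
    rw [h'.unique hs]
    have h6 : r ≠ 6 := by omega
    rw [adjacentRank, Bool.eq_false_iff.mpr fun h => h6 (Nat.beq_eq.mp h)] at had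
    exact Nat.le_of_ble_eq_true had

/-- `X` is a sum of `n` simple tensors; `rank X` is the least such `n`. -/
def IsSumOf (n : ℕ) (X : Tensor) : Prop :=
  ∃ S : Fin n → Tensor, (∀ l, IsSimple (S l)) ∧ X = ∑ l, S l

theorem IsSumOf.full_smul {n : ℕ} {X : Tensor} (h : IsSumOf n X) (g : FullGroup) :
    IsSumOf n (g • X) := by
  obtain ⟨S, hS, rfl⟩ := h
  exact ⟨fun l => g • S l, fun l => (hS l).full_smul g, full_smul_sum g S⟩

theorem IsSumOf.add {n : ℕ} {X S : Tensor} (h : IsSumOf n X) (hS : IsSimple S) :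
    IsSumOf (n + 1) (X + S) := by
  obtain ⟨T, hT, rfl⟩ := h
  refine ⟨Fin.snoc T S, fun l => ?_, ?_⟩
  · induction l using Fin.lastCases with
    | last => simpa using hS
    | cast l => simpa using hT l
  · simp [Fin.sum_univ_castSucc]

theorem HasLabel.le_of_isSumOf {n : ℕ} {X : Tensor} {r : ℕ} (h : HasLabel X r)
    (hX : IsSumOf n X) : r ≤ n := by
  induction n generalizing X r with
  | zero =>
    obtain ⟨S, -, rfl⟩ := hX
    refine (h.unique ⟨⟨0, 1, 0⟩, List.mem_cons_self, rfl, ?_⟩).le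
    rw [Fin.sum_univ_zero, ← decode_zero]
    exact MulAction.mem_orbit_self _
  | succ n ih =>
    obtain ⟨S, hS, rfl⟩ := hX
    rw [Fin.sum_univ_castSucc] at h
    obtain ⟨s, hs⟩ := exists_hasLabel (∑ l : Fin n, S l.castSucc)
    exact (hs.le_succ (hS _) h).trans
      (Nat.succ_le_succ (ih hs ⟨_, fun l => hS l.castSucc, rfl⟩))

/-- Peel off one simple tensor at a time, along the representatives. -/
theorem isSumOf_rank {row : Row} (hrow : row ∈ allRows) : IsSumOf row.rank (decode row.code) := by
  induction hr : row.rank using Nat.strong_induction_on generalizing row with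
  | _ r ih =>
    rcases List.mem_cons.mp hrow with rfl | hrow
    · subst hr
      exact ⟨Fin.elim0, fun l => l.elim0, by rw [decode_zero, Fin.sum_univ_zero]⟩
    · obtain ⟨c, hc⟩ := exists_certificate hrow
      have := List.all_eq_true.mp checkPeels_eq_true _ hc
      rw [Bool.and_eq_true] at this
      obtain ⟨row₁, -, h₁, g₁, hg₁⟩ := exists_row_of_descendsTo this.1
      obtain ⟨row₂, hrow₂, h₂, g₂, hg₂⟩ := exists_row_of_descendsTo this.2
      rw [Nat.beq_eq] at h₁ h₂
      change g₁ • decode row₁.code = decode c.peel at hg₁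
      change g₂ • decode row₂.code = decode (Nat.xor row.code c.peel) at hg₂
      change row₂.rank + 1 = row.rank at h₂
      have hS : IsSimple (decode c.peel) := by
        rw [← hg₁, h₁]
        exact isSimple_decode_one.full_smul g₁
      have hsum := ((ih row₂.rank (by omega) hrow₂ rfl).full_smul g₂).add hS
      rwa [hg₂, decode_xor, add_add_cancel_self, h₂, hr] at hsum

theorem HasLabel.rank_eq {X : Tensor} {r : ℕ} (h : HasLabel X r) : rank X = r := by
  have hX : IsSumOf r X := by
    obtain ⟨row, hrow, rfl, g, rfl⟩ := h
    exact (isSumOf_rank hrow).full_smul g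
  exact le_antisymm (Nat.sInf_le hX)
    (h.le_of_isSumOf (Nat.sInf_mem (s := {n | IsSumOf n X}) ⟨r, hX⟩))

theorem rank_eq_of_mem_orbit_allRows (k : Fin allRows.length) {X : Tensor}
    (hX : X ∈ MulAction.orbit FullGroup (decode (allRows.get k).code)) :
    rank X = (allRows.get k).rank :=
  HasLabel.rank_eq ⟨_, List.get_mem allRows k, rfl, hX⟩

theorem rank_eq_of_mem_orbit_smallRows (k : Fin smallRows.length) {X : Tensor}
    (hX : X ∈ MulAction.orbit GL3Cubed (decode (smallRows.get k).code)) :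
    rank X = (smallRows.get k).rank := by
  have hX := mem_full_orbit_of_mem_orbit hX
  rcases mem_smallRows.mp (List.get_mem smallRows k) with h | ⟨rc, hrc, n, hn, h⟩
  · rw [h] at hX ⊢
    exact HasLabel.rank_eq ⟨_, List.mem_cons_self, rfl, hX⟩
  · rw [h] at hX ⊢
    refine HasLabel.rank_eq ⟨rc.1, List.mem_cons_of_mem _ (mem_table_of_mem_certifiedRows hrc),
      rfl, ?_⟩
    rwa [← MulAction.orbit_eq_iff.mpr (decode_smallCode_mem_orbit hn)]

theorem eq_zero_iff_of_mem_orbit {Γ : Type} [Group Γ] [MulAction Γ Tensor] {t : List Row}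
    (h : Covers Γ t) (hzero : ∀ g : Γ, g • (0 : Tensor) = 0) (k₀ : Fin t.length)
    (h₀ : (t.get k₀).code = 0) (k : Fin t.length) {X : Tensor}
    (hX : X ∈ MulAction.orbit Γ (decode (t.get k).code)) : X = 0 ↔ k = k₀ := by
  have horb : MulAction.orbit Γ (decode (t.get k₀).code) = {0} := by
    rw [h₀, orbit_decode_zero Γ hzero]
  constructor
  · rintro rfl
    exact h.index_unique hX (horb ▸ rfl)
  · rintro rfl
    rwa [horb] at hX

/-! ### Numbers of orbits -/

theorem ncard_nonzeroOrbits {Γ : Type} [Group Γ] [MulAction Γ Tensor] {t : List Row}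
    (h : Covers Γ t) (hzero : ∀ g : Γ, g • (0 : Tensor) = 0) (k₀ : Fin t.length)
    (h₀ : (t.get k₀).code = 0) : (nonzeroOrbits Γ).ncard = t.length - 1 := by
  refine (h.ncard_orbits (fun X => X ≠ 0) (fun k => decide (k ≠ k₀)) fun k X hX => ?_).trans ?_
  · rw [decide_eq_true_iff, Ne, Ne, eq_zero_iff_of_mem_orbit h hzero k₀ h₀ k hX]
  · simp [Finset.filter_ne']

theorem ncard_orbitsOfRank {Γ : Type} [Group Γ] [MulAction Γ Tensor] {t : List Row}
    (h : Covers Γ t)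
    (hrank : ∀ (k : Fin t.length) {X : Tensor},
      X ∈ MulAction.orbit Γ (decode (t.get k).code) → rank X = (t.get k).rank) (r : ℕ) :
    (orbitsOfRank Γ r).ncard =
      (Finset.univ.filter fun k => Nat.beq (t.get k).rank r = true).card :=
  h.ncard_orbits _ _ fun k X hX => by rw [hrank k hX, Nat.beq_eq]

theorem code_lt : ∀ row ∈ allRows, row.code < 2 ^ 27 := by decide +kernel

theorem isCanonicalForm_decode {row : Row} (hrow : row ∈ allRows) :
    IsCanonicalForm (decode row.code) := by
  intro Y hY
  obtain ⟨row', hrow', hmem, hmin⟩ := exists_row_isMin_orbit (decode row.code)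
  obtain ⟨k, hk⟩ := List.get_of_mem hrow
  obtain ⟨k', hk'⟩ := List.get_of_mem hrow'
  have hkk' : k = k' := covers_allRows.index_unique (X := decode row'.code)
    (by rwa [hk]) (by rw [hk']; exact MulAction.mem_orbit_self _)
  have heq : row = row' := by rw [← hk, ← hk', hkk']
  rw [encode_decode (code_lt _ hrow), heq]
  exact hmin Y hY

end TensorsF2

open TensorsF2 in
theorem mainTheorem6 :
    -- the numbers of small and of large orbits of nonzero tensors
    (TensorsF2.nonzeroOrbits TensorsF2.GL3Cubed).ncard = 115 ∧
    (TensorsF2.nonzeroOrbits TensorsF2.FullGroup).ncard = 55 ∧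
    -- the rows of the table represent every large orbit of nonzero tensors exactly once
    (∀ X : TensorsF2.Tensor, X ≠ 0 →
      ∃! row : TensorsF2.Row, row ∈ TensorsF2.table ∧
        X ∈ MulAction.orbit TensorsF2.FullGroup (TensorsF2.decode row.code)) ∧
    -- each row gives the canonical form, the size and the rank of its orbit
    (∀ row ∈ TensorsF2.table,
      TensorsF2.decode row.code ≠ 0 ∧
      TensorsF2.encode (TensorsF2.decode row.code) = row.code ∧
      TensorsF2.IsCanonicalForm (TensorsF2.decode row.code) ∧
      (MulAction.orbit TensorsF2.FullGroup (TensorsF2.decode row.code)).ncard = row.size ∧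
      ∀ Y ∈ MulAction.orbit TensorsF2.FullGroup (TensorsF2.decode row.code),
        TensorsF2.rank Y = row.rank) ∧
    -- the numbers of small orbits, of large orbits and of tensors, for each rank from 0 to 6
    (∀ r : Fin 7,
      (TensorsF2.orbitsOfRank TensorsF2.GL3Cubed r.val).ncard = ![1, 1, 4, 18, 44, 45, 3] r ∧
      (TensorsF2.orbitsOfRank TensorsF2.FullGroup r.val).ncard = ![1, 1, 2, 8, 18, 23, 3] r ∧
      {X : TensorsF2.Tensor | TensorsF2.rank X = r.val}.ncard =
        ![1, 343, 43218, 2372286, 47506872, 83670048, 624960] r) := by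
  have hne : ∀ {X : Tensor} (k : Fin allRows.length),
      X ∈ MulAction.orbit FullGroup (decode (allRows.get k).code) →
        (X = 0 ↔ k = ⟨0, Nat.succ_pos _⟩) :=
    fun k hX => eq_zero_iff_of_mem_orbit covers_allRows full_smul_zero ⟨0, Nat.succ_pos _⟩ rfl k hX
  refine ⟨?_, ?_, fun X hX => ?_, fun row hrow => ?_, fun r => ⟨?_, ?_, ?_⟩⟩
  · rw [ncard_nonzeroOrbits covers_smallRows smul_zero_tensor ⟨0, Nat.succ_pos _⟩ rfl]
    decide +kernel
  · rw [ncard_nonzeroOrbits covers_allRows full_smul_zero ⟨0, Nat.succ_pos _⟩ rfl]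
    rfl
  · obtain ⟨k, hk⟩ := covers_allRows.exists_mem X
    induction k using Fin.cases with
    | zero => exact absurd ((hne _ hk).mpr rfl) hX
    | succ k =>
      refine ⟨table.get k, ⟨List.get_mem _ _, hk⟩, ?_⟩
      rintro row ⟨hrow, hmem⟩
      obtain ⟨m, rfl⟩ := List.get_of_mem hrow
      rw [Fin.succ_injective _ (covers_allRows.index_unique (k := m.succ) hmem hk)]
  · obtain ⟨k, rfl⟩ := List.get_of_mem hrow
    refine ⟨fun h => ?_, encode_decode (code_lt _ (List.mem_cons_of_mem _ hrow)),
      isCanonicalForm_decode (List.mem_cons_of_mem _ hrow), covers_allRows.ncard_eq k.succ,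
      fun Y hY => rank_eq_of_mem_orbit_allRows k.succ hY⟩
    exact Fin.succ_ne_zero k ((hne k.succ (MulAction.mem_orbit_self _)).mp h)
  · rw [ncard_orbitsOfRank covers_smallRows rank_eq_of_mem_orbit_smallRows]
    revert r
    decide +kernel
  · rw [ncard_orbitsOfRank covers_allRows rank_eq_of_mem_orbit_allRows]
    revert r
    decide +kernel
  · rw [covers_allRows.ncard_setOf (fun X => rank X = r.val)
      (fun k => Nat.beq (allRows.get k).rank r.val)
      fun k X hX => by rw [rank_eq_of_mem_orbit_allRows k hX, Nat.beq_eq]]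
    revert r
    decide +kernel
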